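/- Let $N\in\mathbb N$ and let $\Omega\subseteq\mathbb R^N$ be a bounded connected open (non-empty) set with Lipschitz continuous boundary. Let $f:\Omega\times\mathbb R^N\to\overline{\mathbb R}=[-\infty,+\infty]$ be a Borel function and let $F:W^{1,\infty}(\Omega)\to\overline{\mathbb R}$ be the supremal functional $$F(u)=\operatorname*{ess\,sup}_{x\in\Omega} f(x,Du(x)).$$ Assume that there exists a sequence $(u_n)_{n\in\mathbb N}\subseteq W^{1,\infty}(\Omega)$ such that, writing $u_\xi(x):=\xi\cdot x$ for $\xi\in\mathbb R^N$, $$\lim_{n\to\infty}F(u_n)=\inf_{W^{1,\infty}(\Omega)}F\ (\in\overline{\mathbb R})\qquad\text{and}\qquad \limsup_{\xi\to0}F(u_n+u_\xi)=F(u_n)\quad\text{for all } n\in\mathbb N ,$$ where the value at $\xi=0$ is included in the upper limit (so that the second condition says that $\xi\mapsto F(u_n+u_\xi)$ is upper semicontinuous at $\xi=0$). Let $w^*$ be the weak* topology of $W^{1,\infty}(\Omega)$, that is, the topology inherited through $u\mapsto(u,Du)$ from $L^\infty(\Omega)\times L^\infty(\Omega;\mathbb R^N)$ endowed with the weak* topology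 as the dual of $L^1(\Omega)\times L^1(\Omega;\mathbb R^N)$, and let $w^*_{seq}$ be the topology on $W^{1,\infty}(\Omega)$ whose closed sets are the sequentially $w^*$-closed sets. For a topology $\tau$ on $W^{1,\infty}(\Omega)$ let $$\Gamma_\tau(F)=\sup\{G \mid G:W^{1,\infty}(\Omega)\to\overline{\mathbb R}\ \ \tau\text{-lower semicontinuous},\ G\le F\}$$ be the $\tau$-lower semicontinuous envelope of $F$ (pointwise supremum). Then $$\Gamma_{w^*}(F)=\Gamma_{w^*_{seq}}(F).$$ In particular, $F$ is $w^*$-lower semicontinuous if and only if $F$ is sequentially $w^*$-lower semicontinuous, i.e. $F(u)\le\liminf_{n\to\infty}F(v_n)$ whenever $v_n\to u$ in the topology $w^*$. -/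

import Mathlib

open MeasureTheory Filter Topology
open scoped ENNReal ContDiff InnerProductSpace

noncomputable section

/-! ### Lower semicontinuous envelopes and the sequential topology -/

/-- The greatest `t`-lower semicontinuous function below `F`: the pointwise supremum of all
`t`-lower semicontinuous `G ≤ F`. -/
def lscEnvelope {X : Type*} (t : TopologicalSpace X) (F : X → EReal) (x : X) : EReal :=
  ⨆ G ∈ {G : X → EReal | @LowerSemicontinuous X EReal t _ G ∧ G ≤ F}, G x

/-- Sequential lower semicontinuity with respect to the topology `t`. -/
def SeqLowerSemicontinuous {X : Type*} (t : TopologicalSpace X) (F : X → EReal) : Prop :=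
  ∀ (x : X) (y : ℕ → X), Tendsto y atTop (@nhds X t x) →
    F x ≤ liminf (fun n => F (y n)) atTop

/-- The union of two sequentially closed sets is sequentially closed. -/
theorem isSeqClosed_union_aux {X : Type*} [TopologicalSpace X] {A B : Set X}
    (hA : IsSeqClosed A) (hB : IsSeqClosed B) : IsSeqClosed (A ∪ B) := by
  intro y x hy hyx
  by_cases h : ∃ᶠ n in atTop, y n ∈ A
  · obtain ⟨k, hk, hkA⟩ := extraction_of_frequently_atTop h
    exact Or.inl (hA hkA (hyx.comp hk.tendsto_atTop))
  · have h' : ∀ᶠ n in atTop, y n ∈ B := by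
      filter_upwards [not_frequently.1 h] with n hn
      exact (hy n).resolve_left hn
    obtain ⟨k, hk, hkB⟩ := extraction_of_frequently_atTop h'.frequently
    exact Or.inr (hB hkB (hyx.comp hk.tendsto_atTop))

/-- The topology whose closed sets are the sequentially `t`-closed sets. -/
@[reducible] def seqTopology {X : Type*} (t : TopologicalSpace X) : TopologicalSpace X :=
  TopologicalSpace.ofClosed {s | @IsSeqClosed X t s}
    (fun _ _ h _ => (h 0).elim)
    (fun _ hA _ _ hy hyx s hs => hA hs (fun n => hy n s hs) hyx)
    (fun _ hA _ hB => isSeqClosed_union_aux hA hB)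

/-! ### Domains and the Sobolev space `W^{1,∞}(Ω)` -/

/-- `Ω` has Lipschitz continuous boundary: near every boundary point, in suitable orthonormal
coordinates (an axis `e` and its orthogonal hyperplane), `Ω` is the part strictly above the graph
of a Lipschitz function defined on the hyperplane. -/
def HasLipschitzBoundary {N : ℕ} (Ω : Set (EuclideanSpace ℝ (Fin N))) : Prop :=
  ∀ x₀ ∈ frontier Ω, ∃ r > 0, ∃ e : EuclideanSpace ℝ (Fin N), ‖e‖ = 1 ∧
    ∃ (K : NNReal) (γ : (ℝ ∙ e)ᗮ → ℝ), LipschitzWith K γ ∧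
      ∀ x ∈ Metric.ball x₀ r, x ∈ Ω ↔ γ ((ℝ ∙ e)ᗮ.orthogonalProjectionOnto x) < ⟪e, x⟫_ℝ

/-- `g` is the weak gradient of `u` in `Ω`: integration by parts against all test functions
`φ ∈ C_c^∞(Ω)` and in all directions `v`. -/
def IsWeakGradient {N : ℕ} (Ω : Set (EuclideanSpace ℝ (Fin N)))
    (u : EuclideanSpace ℝ (Fin N) → ℝ)
    (g : EuclideanSpace ℝ (Fin N) → EuclideanSpace ℝ (Fin N)) : Prop :=
  ∀ φ : EuclideanSpace ℝ (Fin N) → ℝ, ContDiff ℝ ∞ φ → HasCompactSupport φ → tsupport φ ⊆ Ω →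
    ∀ v : EuclideanSpace ℝ (Fin N),
      ∫ x in Ω, u x * fderiv ℝ φ x v = - ∫ x in Ω, ⟪g x, v⟫_ℝ * φ x

theorem integrable_mul_aux {N : ℕ} (Ω : Set (EuclideanSpace ℝ (Fin N)))
    (u : Lp ℝ ∞ (volume.restrict Ω)) {φ : EuclideanSpace ℝ (Fin N) → ℝ}
    (hφ : ContDiff ℝ ∞ φ) (hc : HasCompactSupport φ) (v : EuclideanSpace ℝ (Fin N)) :
    Integrable (fun x => u x * fderiv ℝ φ x v) (volume.restrict Ω) := by
  have h1 : Integrable (fun x => fderiv ℝ φ x v) (volume.restrict Ω) := by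
    have hcont : Continuous (fun x => fderiv ℝ φ x v) :=
      (hφ.continuous_fderiv (by simp)).clm_apply continuous_const
    exact (hcont.integrable_of_hasCompactSupport (hc.fderiv_apply (𝕜 := ℝ) v)).restrict
  exact (memLp_one_iff_integrable.1
    ((memLp_one_iff_integrable.2 h1).mul (Lp.memLp u)))

theorem integrable_inner_mul_aux {N : ℕ} (Ω : Set (EuclideanSpace ℝ (Fin N)))
    (g : Lp (EuclideanSpace ℝ (Fin N)) ∞ (volume.restrict Ω))
    {φ : EuclideanSpace ℝ (Fin N) → ℝ}
    (hφ : ContDiff ℝ ∞ φ) (hc : HasCompactSupport φ) (v : EuclideanSpace ℝ (Fin N)) :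
    Integrable (fun x => ⟪g x, v⟫_ℝ * φ x) (volume.restrict Ω) := by
  have h1 : Integrable φ (volume.restrict Ω) :=
    (hφ.continuous.integrable_of_hasCompactSupport hc).restrict
  exact (memLp_one_iff_integrable.1
    ((memLp_one_iff_integrable.2 h1).mul ((Lp.memLp g).inner_const v)))

/-- The space `W^{1,∞}(Ω)`, realised inside `L^∞(Ω) × L^∞(Ω; ℝ^N)` as the set of pairs `(u, Du)`
where `Du` is the weak gradient of `u`. For open `Ω` the second component is determined by the
first, see `weakGradient_unique`. -/
def W1inf {N : ℕ} (Ω : Set (EuclideanSpace ℝ (Fin N))) :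
    Submodule ℝ (Lp ℝ ∞ (volume.restrict Ω) ×
      Lp (EuclideanSpace ℝ (Fin N)) ∞ (volume.restrict Ω)) where
  carrier := {p | IsWeakGradient Ω p.1 p.2}
  zero_mem' := by
    intro φ _ _ _ v
    have h1 : ∫ x in Ω, (0 : Lp ℝ ∞ (volume.restrict Ω)) x * fderiv ℝ φ x v = 0 := by
      refine integral_eq_zero_of_ae ?_
      filter_upwards [Lp.coeFn_zero ℝ ∞ (volume.restrict Ω)] with x hx
      rw [hx]; simp
    have h2 : ∫ x in Ω, ⟪(0 : Lp (EuclideanSpace ℝ (Fin N)) ∞ (volume.restrict Ω)) x, v⟫_ℝ * φ x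
        = 0 := by
      refine integral_eq_zero_of_ae ?_
      filter_upwards [Lp.coeFn_zero (EuclideanSpace ℝ (Fin N)) ∞ (volume.restrict Ω)] with x hx
      rw [hx]; simp
    exact h1.trans (by rw [← neg_zero]; exact congrArg Neg.neg h2.symm)
  add_mem' := by
    intro p q hp hq φ hφ hc hs v
    have h1 : ∫ x in Ω, (p.1 + q.1) x * fderiv ℝ φ x v
        = (∫ x in Ω, p.1 x * fderiv ℝ φ x v) + ∫ x in Ω, q.1 x * fderiv ℝ φ x v := by
      rw [← integral_add (integrable_mul_aux Ω p.1 hφ hc v) (integrable_mul_aux Ω q.1 hφ hc v)]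
      refine integral_congr_ae ?_
      filter_upwards [Lp.coeFn_add p.1 q.1] with x hx
      rw [hx, Pi.add_apply, add_mul]
    have h2 : ∫ x in Ω, ⟪(p.2 + q.2) x, v⟫_ℝ * φ x
        = (∫ x in Ω, ⟪p.2 x, v⟫_ℝ * φ x) + ∫ x in Ω, ⟪q.2 x, v⟫_ℝ * φ x := by
      rw [← integral_add (integrable_inner_mul_aux Ω p.2 hφ hc v)
        (integrable_inner_mul_aux Ω q.2 hφ hc v)]
      refine integral_congr_ae ?_
      filter_upwards [Lp.coeFn_add p.2 q.2] with x hx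
      rw [hx, Pi.add_apply, inner_add_left, add_mul]
    refine h1.trans ?_
    rw [hp φ hφ hc hs v, hq φ hφ hc hs v, ← neg_add]
    exact congrArg Neg.neg h2.symm
  smul_mem' := by
    intro c p hp φ hφ hc hs v
    have h1 : ∫ x in Ω, (c • p.1) x * fderiv ℝ φ x v
        = c * ∫ x in Ω, p.1 x * fderiv ℝ φ x v := by
      rw [← integral_const_mul]
      refine integral_congr_ae ?_
      filter_upwards [Lp.coeFn_smul c p.1] with x hx
      rw [hx, Pi.smul_apply, smul_eq_mul, mul_assoc]
    have h2 : ∫ x in Ω, ⟪(c • p.2) x, v⟫_ℝ * φ x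
        = c * ∫ x in Ω, ⟪p.2 x, v⟫_ℝ * φ x := by
      rw [← integral_const_mul]
      refine integral_congr_ae ?_
      filter_upwards [Lp.coeFn_smul c p.2] with x hx
      rw [hx, Pi.smul_apply, real_inner_smul_left, mul_assoc]
    refine h1.trans ?_
    rw [hp φ hφ hc hs v, mul_neg]
    exact congrArg Neg.neg h2.symm

/-- The weak gradient `Du` of `u ∈ W^{1,∞}(Ω)`. -/
def W1inf.grad {N : ℕ} {Ω : Set (EuclideanSpace ℝ (Fin N))} (u : W1inf Ω) :
    Lp (EuclideanSpace ℝ (Fin N)) ∞ (volume.restrict Ω) := u.1.2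

/-- The underlying function of `u ∈ W^{1,∞}(Ω)`, as an element of `L^∞(Ω)`. -/
def W1inf.fn {N : ℕ} {Ω : Set (EuclideanSpace ℝ (Fin N))} (u : W1inf Ω) :
    Lp ℝ ∞ (volume.restrict Ω) := u.1.1

/-- On an open set, an element of `W^{1,∞}(Ω)` is determined by its underlying function. -/
theorem weakGradient_unique {N : ℕ} {Ω : Set (EuclideanSpace ℝ (Fin N))} (hΩ : IsOpen Ω) :
    Function.Injective (W1inf.fn (Ω := Ω)) := by
  intro p q hpq
  have key : ∀ v : EuclideanSpace ℝ (Fin N),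
      ∀ᵐ x ∂(volume.restrict Ω), ⟪W1inf.grad p x, v⟫_ℝ - ⟪W1inf.grad q x, v⟫_ℝ = 0 := by
    intro v
    have hloc : LocallyIntegrableOn (fun x => ⟪W1inf.grad p x, v⟫_ℝ - ⟪W1inf.grad q x, v⟫_ℝ) Ω volume := by
      have hm : MemLp (fun x => ⟪W1inf.grad p x, v⟫_ℝ - ⟪W1inf.grad q x, v⟫_ℝ) ∞ (volume.restrict Ω) :=
        ((Lp.memLp (W1inf.grad p)).inner_const v).sub ((Lp.memLp (W1inf.grad q)).inner_const v)
      exact locallyIntegrableOn_of_locallyIntegrable_restrict (hm.locallyIntegrable le_top)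
    refine (ae_restrict_iff' hΩ.measurableSet).2
      (hΩ.ae_eq_zero_of_integral_contDiff_smul_eq_zero hloc ?_)
    intro φ hφ hc hs
    have e1 := p.2 φ hφ hc hs v
    have e2 := q.2 φ hφ hc hs v
    have e3 : p.1.1 = q.1.1 := hpq
    rw [e3, e2, neg_inj] at e1
    have i1 := integrable_inner_mul_aux Ω p.1.2 hφ hc v
    have i2 := integrable_inner_mul_aux Ω q.1.2 hφ hc v
    have e4 := integral_sub i1 i2
    rw [e1, sub_self] at e4
    rw [← setIntegral_eq_integral_of_forall_compl_eq_zero (s := Ω)]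
    · rw [← e4]
      refine integral_congr_ae (Eventually.of_forall fun x => ?_)
      simp only [W1inf.grad, smul_eq_mul]
      ring
    · intro x hx
      have : φ x = 0 := image_eq_zero_of_notMem_tsupport fun h => hx (hs h)
      simp [this]
  have hall : ∀ᵐ x ∂(volume.restrict Ω), ∀ i : Fin N,
      ⟪W1inf.grad p x, EuclideanSpace.single i (1 : ℝ)⟫_ℝ
        - ⟪W1inf.grad q x, EuclideanSpace.single i (1 : ℝ)⟫_ℝ = 0 :=
    ae_all_iff.2 fun i => key _
  have hg : W1inf.grad p = W1inf.grad q := by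
    refine Lp.ext ?_
    filter_upwards [hall] with x hx
    ext i
    have := hx i
    simp only [EuclideanSpace.inner_single_right] at this
    simpa [sub_eq_zero] using this
  exact Subtype.ext (Prod.ext hpq hg)

/-- The function `x ↦ ξ · x` is bounded on a bounded set. -/
theorem memLp_inner_aux {N : ℕ} {Ω : Set (EuclideanSpace ℝ (Fin N))}
    (hb : Bornology.IsBounded Ω) (ξ : EuclideanSpace ℝ (Fin N)) :
    MemLp (fun x => ⟪ξ, x⟫_ℝ) ∞ (volume.restrict Ω) := by
  obtain ⟨R, hR⟩ := hb.subset_closedBall 0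
  have h : MemLp (fun x => ⟪ξ, x⟫_ℝ) ∞
      (volume.restrict (Metric.closedBall (0 : EuclideanSpace ℝ (Fin N)) R)) := by
    refine memLp_top_of_bound (by fun_prop) (‖ξ‖ * R) ?_
    filter_upwards [ae_restrict_mem Metric.isClosed_closedBall.measurableSet] with x hx
    refine (norm_inner_le_norm ξ x).trans ?_
    have : ‖x‖ ≤ R := by simpa using hx
    gcongr
  exact h.mono_measure (Measure.restrict_mono hR le_rfl)

/-- The weak gradient of `x ↦ ξ · x` is the constant `ξ`. -/
theorem isWeakGradient_inner_aux {N : ℕ} (Ω : Set (EuclideanSpace ℝ (Fin N)))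
    (ξ : EuclideanSpace ℝ (Fin N)) : IsWeakGradient Ω (fun x => ⟪ξ, x⟫_ℝ) (fun _ => ξ) := by
  intro φ hφ hc hs v
  have hd : ∀ x, x ∉ Ω → fderiv ℝ φ x = 0 := fun x hx =>
    image_eq_zero_of_notMem_tsupport fun h => hx (hs (tsupport_fderiv_subset ℝ h))
  have hz : ∀ x, x ∉ Ω → φ x = 0 := fun x hx =>
    image_eq_zero_of_notMem_tsupport fun h => hx (hs h)
  rw [setIntegral_eq_integral_of_forall_compl_eq_zero (fun x hx => by simp [hd x hx]),
    setIntegral_eq_integral_of_forall_compl_eq_zero (fun x hx => by simp [hz x hx])]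
  have hcont : Continuous (fun x => fderiv ℝ φ x v) :=
    (hφ.continuous_fderiv (by simp)).clm_apply continuous_const
  have hder : ∀ x, fderiv ℝ (fun y => ⟪ξ, y⟫_ℝ) x v = ⟪ξ, v⟫_ℝ := by
    intro x
    have : (fun y => ⟪ξ, y⟫_ℝ) = fun y => innerSL ℝ ξ y := by ext y; simp
    rw [this, ContinuousLinearMap.fderiv]
    simp
  have hφ' : Differentiable ℝ φ := hφ.differentiable (by simp)
  have := integral_mul_fderiv_eq_neg_fderiv_mul_of_integrable (μ := volume)
    (f := fun y => ⟪ξ, y⟫_ℝ) (g := φ) (v := v) ?_ ?_ ?_ ?_ ?_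
  · simpa [hder] using this
  · simp only [hder]
    exact (hφ.continuous.integrable_of_hasCompactSupport hc).const_mul _
  · exact (Continuous.mul (by fun_prop) hcont).integrable_of_hasCompactSupport
      ((hc.fderiv_apply (𝕜 := ℝ) v).mul_left)
  · exact (Continuous.mul (by fun_prop) hφ.continuous).integrable_of_hasCompactSupport hc.mul_left
  · exact fun x _ => (innerSL ℝ ξ).differentiableAt
  · exact fun x _ => hφ' x

/-- The linear function `u_ξ(x) = ξ · x`, as an element of `W^{1,∞}(Ω)` for bounded `Ω`. -/
def W1inf.linear {N : ℕ} {Ω : Set (EuclideanSpace ℝ (Fin N))} (hb : Bornology.IsBounded Ω)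
    (ξ : EuclideanSpace ℝ (Fin N)) : W1inf Ω :=
  ⟨((memLp_inner_aux hb ξ).toLp _, (memLp_top_const ξ).toLp _), by
    intro φ hφ hc hs v
    have h := isWeakGradient_inner_aux Ω ξ φ hφ hc hs v
    have h1 : ∫ x in Ω, ((memLp_inner_aux hb ξ).toLp _ : EuclideanSpace ℝ (Fin N) → ℝ) x
        * fderiv ℝ φ x v = ∫ x in Ω, ⟪ξ, x⟫_ℝ * fderiv ℝ φ x v := by
      refine integral_congr_ae ?_
      filter_upwards [(memLp_inner_aux hb ξ).coeFn_toLp] with x hx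
      rw [hx]
    have h2 : ∫ x in Ω, ⟪((memLp_top_const (μ := volume.restrict Ω) ξ).toLp _ :
          EuclideanSpace ℝ (Fin N) → EuclideanSpace ℝ (Fin N)) x, v⟫_ℝ * φ x
        = ∫ x in Ω, ⟪ξ, v⟫_ℝ * φ x := by
      refine integral_congr_ae ?_
      filter_upwards [(memLp_top_const (μ := volume.restrict Ω) ξ).coeFn_toLp] with x hx
      rw [hx]
    exact h1.trans (h.trans (congrArg Neg.neg h2.symm))⟩

/-- The weak* topology of `W^{1,∞}(Ω)`: the one inherited from `L^∞(Ω) × L^∞(Ω; ℝ^N)`, the dual of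
`L^1(Ω) × L^1(Ω; ℝ^N)`, i.e. the coarsest topology that makes all the pairings
`u ↦ ∫ u h + ∫ Du · k` with `h ∈ L^1(Ω)`, `k ∈ L^1(Ω; ℝ^N)` continuous. -/
@[reducible] def W1inf.weakStar {N : ℕ} (Ω : Set (EuclideanSpace ℝ (Fin N))) : TopologicalSpace (W1inf Ω) :=
  TopologicalSpace.induced
    (fun (u : W1inf Ω) (p : Lp ℝ 1 (volume.restrict Ω) ×
        Lp (EuclideanSpace ℝ (Fin N)) 1 (volume.restrict Ω)) =>
      (∫ x in Ω, W1inf.fn u x * p.1 x) + ∫ x in Ω, ⟪W1inf.grad u x, p.2 x⟫_ℝ)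
    Pi.topologicalSpace

/-! ### Supremal functionals -/

/-- The supremal functional `F(u) = ess sup_{x ∈ Ω} f(x, Du(x))` with supremand `f`; only the
values of `f` on `Ω × ℝ^N` matter. -/
def supremal {N : ℕ} (Ω : Set (EuclideanSpace ℝ (Fin N)))
    (f : EuclideanSpace ℝ (Fin N) → EuclideanSpace ℝ (Fin N) → EReal) (u : W1inf Ω) : EReal :=
  essSup (fun x => f x (W1inf.grad u x)) (volume.restrict Ω)

/-- There is a minimizing sequence `u_n` for `F` such that
`limsup_{ξ → 0} F(u_n + u_ξ) = F(u_n)` for all `n`, where `u_ξ(x) = ξ · x`. -/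
def HasContinuityMinimizingSeq {N : ℕ} {Ω : Set (EuclideanSpace ℝ (Fin N))}
    (hb : Bornology.IsBounded Ω) (F : W1inf Ω → EReal) : Prop :=
  ∃ u : ℕ → W1inf Ω, Tendsto (fun n => F (u n)) atTop (𝓝 (⨅ v, F v)) ∧
    ∀ n, limsup (fun ξ => F (u n + W1inf.linear hb ξ)) (𝓝 0) = F (u n)

end

noncomputable section

/-! ### Envelopes and sequential closures -/

/-! Both claims reduce to one fact: for every level c, the closure K of {F ≤ c} in the sequential
topology is weak* closed. Given this, the function equal to ⊥ on K and to c elsewhere is weak* lower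
semicontinuous and lies below F. If G ≤ F is lower semicontinuous for the sequential topology and c
< G x, then K ⊆ {G ≤ c} misses x, so this function takes the value c at x; such competitors recover
the sequential envelope (`lscEnvelope_eq_seqTopology`).

Closedness of K comes from convexity. Through `W1inf.toDual`, W^{1,∞}(Ω) is a sequentially weak*
closed subspace of the dual of the separable Banach space L¹ × L¹, where convex sequentially weak*
closed sets are weak* closed (`Convex.isClosed_of_isSeqClosed_weakDual`).

Convexity holds although f has no convexity at all. For w₁, w₂ in {F ≤ c} and d = w₂ - w₁, compose d
with staircase functions that have slopes 0 and 1 only and converge to s ↦ t * s. By the chain rule,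
w₁ plus this composition has gradient Dw₁ or Dw₂ at almost every point, so it stays in {F ≤ c},
while it converges weak* to w₁ + t d (`exists_seq_supremal_le_tendsto`). Hence segments between
points of {F ≤ c} lie in K, and this passes to K itself (`convex_closure_seqTopology`). -/

theorem isClosed_seqTopology_iff {X : Type*} (t : TopologicalSpace X) {s : Set X} :
    IsClosed[seqTopology t] s ↔ @IsSeqClosed X t s := by
  rw [← @isOpen_compl_iff X s (seqTopology t)]
  change sᶜᶜ ∈ {s | @IsSeqClosed X t s} ↔ _
  rw [compl_compl]; rfl

theorem seqTopology_le {X : Type*} (t : TopologicalSpace X) : seqTopology t ≤ t := by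
  intro s hs
  rw [← @isClosed_compl_iff X t] at hs
  rw [← @isClosed_compl_iff X (seqTopology t), isClosed_seqTopology_iff]
  exact @IsClosed.isSeqClosed X t _ hs

theorem LowerSemicontinuous.seqLowerSemicontinuous {X : Type*} {t : TopologicalSpace X}
    {F : X → EReal} (hF : LowerSemicontinuous F) : SeqLowerSemicontinuous t F := by
  intro x y hy
  refine le_of_forall_lt fun c hc => ?_
  obtain ⟨b, hcb, hb⟩ := exists_between hc
  refine hcb.trans_le (le_liminf_of_le (by isBoundedDefault) ?_)
  filter_upwards [hy (hF x b hb)] with n hn using le_of_lt hn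

theorem SeqLowerSemicontinuous.isSeqClosed_sublevel {X : Type*} {t : TopologicalSpace X}
    {F : X → EReal} (hF : SeqLowerSemicontinuous t F) (c : EReal) :
    IsSeqClosed {x | F x ≤ c} := by
  intro y x hy hyx
  refine (hF x y hyx).trans ?_
  exact liminf_le_of_frequently_le (Frequently.of_forall hy) (by isBoundedDefault)

/-- Supplies the two-valued competitors from which the topological envelope is bounded below. -/
theorem lowerSemicontinuous_ite_mem {X : Type*} [TopologicalSpace X] {K : Set X}
    [DecidablePred (· ∈ K)] (hK : IsClosed K) (c : EReal) :
    LowerSemicontinuous fun x => if x ∈ K then (⊥ : EReal) else c := by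
  intro x b hb
  by_cases hx : x ∈ K
  · simp [hx] at hb
  · simp only [hx, if_false] at hb
    filter_upwards [hK.isOpen_compl.mem_nhds hx] with y hy
    rw [if_neg hy]
    exact hb

/-- If the sequential-topology closures of the sublevel sets of `F` are closed, then the topological
and sequential envelopes coincide. -/
theorem lscEnvelope_eq_seqTopology {X : Type*} (t : TopologicalSpace X) (F : X → EReal)
    (H : ∀ c, IsClosed (@closure X (seqTopology t) {x | F x ≤ c})) :
    lscEnvelope t F = lscEnvelope (seqTopology t) F := by
  classical
  funext x
  refine le_antisymm ?_ ?_
  · refine iSup₂_le fun G hG => ?_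
    refine le_iSup₂_of_le G ⟨?_, hG.2⟩ le_rfl
    intro y b hb
    exact (nhds_mono (seqTopology_le t)) (hG.1 y b hb)
  · refine iSup₂_le fun G hG => ?_
    refine le_of_forall_lt fun c hc => ?_
    obtain ⟨c', hcc', hc'⟩ := exists_between hc
    have hcl : IsClosed[seqTopology t] {y | G y ≤ c'} :=
      (@lowerSemicontinuous_iff_isClosed_preimage X (seqTopology t) EReal _ G).1 hG.1 c'
    have hsub : @closure X (seqTopology t) {y | F y ≤ c'} ⊆ {y | G y ≤ c'} :=
      @closure_minimal X (seqTopology t) _ _ (fun y hy => (hG.2 y).trans hy) hcl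
    have hx : x ∉ @closure X (seqTopology t) {y | F y ≤ c'} := fun h => not_le.2 hc' (hsub h)
    -- This competitor lies below `F`: where `F ≤ c'` the point is in the closure and the value is
    -- `⊥`, elsewhere `F` exceeds `c'`. At `x` it equals `c'`.
    refine hcc'.trans_le (le_iSup₂_of_le
      (fun y => if y ∈ @closure X (seqTopology t) {y | F y ≤ c'} then (⊥ : EReal) else c')
      ⟨lowerSemicontinuous_ite_mem (H c') c', fun y => ?_⟩ ?_)
    · by_cases hy : F y ≤ c'
      · have : y ∈ @closure X (seqTopology t) {y | F y ≤ c'} :=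
          @subset_closure X (seqTopology t) {y | F y ≤ c'} y hy
        simp [this]
      · dsimp only
        split_ifs
        · exact bot_le
        · exact (not_le.1 hy).le
    · exact (if_neg hx).ge

theorem lowerSemicontinuous_iff_seqLowerSemicontinuous {X : Type*} (t : TopologicalSpace X)
    (F : X → EReal) (H : ∀ c, IsClosed (@closure X (seqTopology t) {x | F x ≤ c})) :
    LowerSemicontinuous F ↔ SeqLowerSemicontinuous t F := by
  refine ⟨fun h => h.seqLowerSemicontinuous, fun h => ?_⟩
  refine lowerSemicontinuous_iff_isClosed_preimage.2 fun c => ?_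
  have := H c
  rwa [@IsClosed.closure_eq X (seqTopology t) _
    ((isClosed_seqTopology_iff t).2 (h.isSeqClosed_sublevel c))] at this

/-- If all segments between points of `S` consist of limits of sequences in `S`, then the closure of
`S` in the sequential topology is convex. -/
theorem convex_closure_seqTopology {V : Type*} [AddCommGroup V] [Module ℝ V]
    [t : TopologicalSpace V] [ContinuousAdd V] [ContinuousConstSMul ℝ V] {S : Set V}
    (hS : ∀ x ∈ S, ∀ y ∈ S, ∀ a b : ℝ, 0 < a → 0 < b → a + b = 1 →
      ∃ z : ℕ → V, (∀ n, z n ∈ S) ∧ Tendsto z atTop (𝓝 (a • x + b • y))) :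
    Convex ℝ (@closure V (seqTopology t) S) := by
  set K := @closure V (seqTopology t) S with hKdef
  have hK : IsSeqClosed K := (isClosed_seqTopology_iff t).1 (@isClosed_closure V (seqTopology t) S)
  have hSK : S ⊆ K := @subset_closure V (seqTopology t) S
  have hmin : ∀ A : Set V, IsSeqClosed A → S ⊆ A → K ⊆ A := fun A hA h =>
    @closure_minimal V (seqTopology t) _ _ h ((isClosed_seqTopology_iff t).2 hA)
  rw [convex_iff_forall_pos]
  intro x hx y hy a b ha hb hab
  -- Points of `K` need not be limits of sequences in `S`, so convexity is extended one variable at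
  -- a time: for a fixed second point, the admissible first points form a sequentially closed set
  -- containing `S`, hence `K`; then the roles are exchanged.
  have h1 : ∀ y ∈ S, K ⊆ {x | a • x + b • y ∈ K} := fun y hy =>
    hmin _ (fun u u₀ hu huu => hK hu ((huu.const_smul a).add_const _)) fun x hx => by
      obtain ⟨z, hz, hzl⟩ := hS x hx y hy a b ha hb hab
      exact hK (fun n => hSK (hz n)) hzl
  have h2 : K ⊆ {y | a • x + b • y ∈ K} :=
    hmin _ (fun u u₀ hu huu => hK hu ((huu.const_smul b).const_add _)) fun y hy => h1 y hy hx
  exact h2 hy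

/-! ### The Krein–Šmulian theorem for separable preduals -/

section KreinSmulian

variable {E : Type*} [NormedAddCommGroup E] [NormedSpace ℝ E]

/-- Separability of `E` makes dual balls weak* metrizable, so on them sequentially closed means
closed; Banach–Alaoglu then gives compactness. -/
theorem isCompact_inter_closedBall_of_isSeqClosed [TopologicalSpace.SeparableSpace E]
    {D : Set (WeakDual ℝ E)} (hD : IsSeqClosed D) (r : ℝ) :
    IsCompact (D ∩ WeakDual.toStrongDual ⁻¹' Metric.closedBall (0 : StrongDual ℝ E) r) := by
  set B : Set (WeakDual ℝ E) := WeakDual.toStrongDual ⁻¹' Metric.closedBall 0 r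
  have hB : IsCompact B := WeakDual.isCompact_closedBall 0 r
  have : TopologicalSpace.MetrizableSpace B := WeakDual.metrizable_of_isCompact ℝ E B hB
  have : CompactSpace B := isCompact_iff_compactSpace.1 hB
  have h1 : IsSeqClosed ((↑) ⁻¹' D : Set B) := fun u x hu hx =>
    hD hu ((continuous_subtype_val.tendsto x).comp hx)
  have h2 := (h1.isClosed.isCompact).image (continuous_subtype_val (p := (· ∈ B)))
  rwa [Subtype.image_preimage_coe, Set.inter_comm] at h2

/-- Weak* closed sets are norm closed, so `0` has positive norm distance from `D`. This starts the
induction below with the empty set of test points. -/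
theorem exists_closedBall_disjoint {D : Set (WeakDual ℝ E)}
    (hD : IsClosed (D ∩ WeakDual.toStrongDual ⁻¹' Metric.closedBall (0 : StrongDual ℝ E) 1))
    (h0 : (0 : WeakDual ℝ E) ∉ D) :
    ∃ δ > 0, ∀ d ∈ D, δ < ‖WeakDual.toStrongDual d‖ := by
  have hop : IsOpen (StrongDual.toWeakDual (𝕜 := ℝ) (E := E) ⁻¹'
      (D ∩ WeakDual.toStrongDual ⁻¹' Metric.closedBall (0 : StrongDual ℝ E) 1)ᶜ) :=
    hD.isOpen_compl.preimage NormedSpace.Dual.toWeakDual_continuous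
  obtain ⟨ε, hε, hsub⟩ := Metric.isOpen_iff.1 hop 0 (fun h => h0 (by simpa using h.1))
  -- The cap `1` keeps `d` in the unit ball, where closedness is assumed; `ε / 2` puts it in the
  -- open ball.
  refine ⟨min (ε / 2) 1, by positivity, fun d hd => ?_⟩
  by_contra! hle
  have h1 : ‖WeakDual.toStrongDual d‖ < ε :=
    (hle.trans (min_le_left _ _)).trans_lt (half_lt_self hε)
  exact hsub (by simpa using h1 : WeakDual.toStrongDual d ∈ Metric.ball 0 ε)
    ⟨hd, by simpa using hle.trans (min_le_right _ _)⟩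

/-- The inductive step of the Krein–Šmulian theorem. -/
theorem exists_finite_polar_disjoint {D : Set (WeakDual ℝ E)}
    (hD : ∀ r, IsCompact (D ∩ WeakDual.toStrongDual ⁻¹' Metric.closedBall (0 : StrongDual ℝ E) r))
    {r r' : ℝ} (hr : 0 < r) {G : Set E} (hG : G.Finite)
    (h : ∀ d ∈ D, ‖WeakDual.toStrongDual d‖ ≤ r → ∃ x ∈ G, 1 < |d x|) :
    ∃ G' : Set E, G'.Finite ∧ G ⊆ G' ∧ G' ⊆ G ∪ Metric.closedBall 0 r⁻¹ ∧
      ∀ d ∈ D, ‖WeakDual.toStrongDual d‖ ≤ r' → ∃ x ∈ G', 1 < |d x| := by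
  have hclosed : ∀ x : E, IsClosed {d : WeakDual ℝ E | |d x| ≤ 1} := fun x =>
    isClosed_le (WeakDual.eval_continuous x).abs continuous_const
  have hcpt : IsCompact ((D ∩ WeakDual.toStrongDual ⁻¹'
      Metric.closedBall (0 : StrongDual ℝ E) r') ∩ ⋂ x ∈ G, {d : WeakDual ℝ E | |d x| ≤ 1}) :=
    (hD r').inter_right (isClosed_biInter fun x _ => hclosed x)
  -- The polar of the ball of radius `r⁻¹` is the ball of radius `r`. A functional bounded by 1 on
  -- `G` and on that whole ball would have norm at most `r` and contradict `h`; by compactness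
  -- finitely many points of the ball already exclude it.
  obtain ⟨u, hu⟩ := hcpt.elim_finite_subfamily_closed
    (fun x : Metric.closedBall (0 : E) r⁻¹ => {d : WeakDual ℝ E | |d x| ≤ 1})
    (fun x => hclosed x) (by
      rw [Set.eq_empty_iff_forall_notMem]
      rintro d ⟨⟨⟨hd, -⟩, hdG⟩, hdB⟩
      simp only [Set.mem_iInter, Set.mem_ofPred_eq] at hdG hdB
      have hmem : WeakDual.toStrongDual d ∈ StrongDual.polar ℝ (Metric.closedBall (0 : E) r⁻¹) := by
        intro x hx
        exact hdB ⟨x, hx⟩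
      rw [NormedSpace.polar_closedBall (inv_pos.2 hr), inv_inv] at hmem
      obtain ⟨x, hx, hlt⟩ := h d hd (by simpa using hmem)
      exact absurd (hdG x hx) (not_le.2 hlt))
  refine ⟨G ∪ (↑) '' (u : Set (Metric.closedBall (0 : E) r⁻¹)), hG.union (u.finite_toSet.image _),
    Set.subset_union_left, Set.union_subset_union_right _ ?_, fun d hd hdr => ?_⟩
  · rintro _ ⟨x, -, rfl⟩
    exact x.2
  · by_contra! hcon
    refine (Set.eq_empty_iff_forall_notMem.1 hu) d ⟨⟨⟨hd, by simpa using hdr⟩, ?_⟩, ?_⟩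
    · simp only [Set.mem_iInter, Set.mem_ofPred_eq]
      exact fun x hx => hcon x (Or.inl hx)
    · simp only [Set.mem_iInter, Set.mem_ofPred_eq]
      exact fun x hx => hcon x (Or.inr ⟨x, hx, rfl⟩)

/-- The points added at stage n have norm at most 1 / (δ (n + 1)), so all but finitely many points
of the union lie in any given ball about 0. -/
theorem exists_totallyBounded_one_lt {D : Set (WeakDual ℝ E)}
    (hD : ∀ r, IsCompact (D ∩ WeakDual.toStrongDual ⁻¹' Metric.closedBall (0 : StrongDual ℝ E) r))
    (h0 : (0 : WeakDual ℝ E) ∉ D) :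
    ∃ T : Set E, TotallyBounded T ∧ ∀ d ∈ D, ∃ x ∈ T, 1 < |d x| := by
  obtain ⟨δ, hδ, hδD⟩ := exists_closedBall_disjoint (hD 1).isClosed h0
  let S : ℕ → Type _ := fun n => {G : Set E // G.Finite ∧
    ∀ d ∈ D, ‖WeakDual.toStrongDual d‖ ≤ δ * (n + 1) → ∃ x ∈ G, 1 < |d x|}
  have hr : ∀ n : ℕ, 0 < δ * (n + 1) := fun n => by positivity
  have hstep : ∀ n (G : S n), ∃ G' : S (n + 1), G.1 ⊆ G'.1 ∧
      G'.1 ⊆ G.1 ∪ Metric.closedBall 0 (δ * (n + 1))⁻¹ := by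
    intro n G
    obtain ⟨G', h1, h2, h3, h4⟩ := exists_finite_polar_disjoint hD (hr n)
      (r' := δ * ((n + 1 : ℕ) + 1)) G.2.1 G.2.2
    exact ⟨⟨G', h1, h4⟩, h2, h3⟩
  choose next hnext1 hnext2 using hstep
  -- Stage 0 needs no test points, because no element of `D` has norm at most `δ`.
  let G : ∀ n, S n := fun n => Nat.rec (motive := S)
    ⟨∅, Set.finite_empty, fun d hd hle => absurd (hδD d hd) (by simpa using hle)⟩ next n
  have hmono : Monotone fun n => (G n).1 := monotone_nat_of_le_succ fun n => hnext1 n (G n)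
  refine ⟨⋃ n, (G n).1, ?_, fun d hd => ?_⟩
  · rw [Metric.totallyBounded_iff]
    intro ε hε
    obtain ⟨n, hn⟩ := exists_nat_gt (ε * δ)⁻¹
    have hnε : (δ * (n + 1))⁻¹ < ε := by
      rw [inv_lt_comm₀ (hr n) hε]
      have : ε⁻¹ = δ * (ε * δ)⁻¹ := by field_simp
      rw [this]
      gcongr
      linarith
    have key : ∀ m, (G m).1 ⊆ (G n).1 ∪ Metric.closedBall 0 (δ * (n + 1))⁻¹ := by
      intro m
      rcases le_total m n with hmn | hmn
      · exact (hmono hmn).trans Set.subset_union_left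
      · induction m, hmn using Nat.le_induction with
        | base => exact Set.subset_union_left
        | succ m hmn ih =>
          refine (hnext2 m (G m)).trans (Set.union_subset ih ?_)
          refine (Metric.closedBall_subset_closedBall ?_).trans Set.subset_union_right
          gcongr
    refine ⟨(G n).1 ∪ {0}, (G n).2.1.union (Set.finite_singleton 0), ?_⟩
    refine Set.iUnion_subset fun m x hx => ?_
    rcases key m hx with hx | hx
    · exact Set.mem_biUnion (Or.inl hx) (Metric.mem_ball_self hε)
    · exact Set.mem_biUnion (Or.inr rfl) ((Metric.mem_closedBall.1 hx).trans_lt hnε)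
  · obtain ⟨n, hn⟩ := exists_nat_gt (‖WeakDual.toStrongDual d‖ / δ)
    obtain ⟨x, hx, hlt⟩ := (G n).2.2 d hd (by
      rw [div_lt_iff₀ hδ] at hn
      nlinarith)
    exact ⟨x, Set.mem_iUnion.2 ⟨n, hx⟩, hlt⟩

/-- Every `d ∈ D` exceeds 1 somewhere on the closed absolutely convex hull `K` of a totally bounded
set. This hull is norm compact, so Sion's minimax theorem exchanges the quantifiers and produces a
single point of `K` that works for all `d`. -/
theorem exists_half_lt_of_isCompact_inter_closedBall [CompleteSpace E] {D : Set (WeakDual ℝ E)}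
    (hc : Convex ℝ D)
    (hD : ∀ r, IsCompact (D ∩ WeakDual.toStrongDual ⁻¹' Metric.closedBall (0 : StrongDual ℝ E) r))
    (h0 : (0 : WeakDual ℝ E) ∉ D) :
    ∃ h : E, ∀ d ∈ D, 1 / 2 ≤ d h := by
  rcases D.eq_empty_or_nonempty with rfl | ⟨d₀, hd₀⟩
  · exact ⟨0, by simp⟩
  obtain ⟨T, hT, hTD⟩ := exists_totallyBounded_one_lt hD h0
  set K := closedAbsConvexHull ℝ T
  have hKc : IsCompact K := isCompact_closedAbsConvexHull_of_totallyBounded hT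
  have hTK : T ⊆ K := subset_closedAbsConvexHull
  have hK : AbsConvex ℝ K := absConvex_convexClosedHull
  have hKD : ∀ d ∈ D, ∃ x ∈ K, 1 < d x := fun d hd => by
    obtain ⟨x, hx, hlt⟩ := hTD d hd
    rcases lt_abs.1 hlt with h | h
    · exact ⟨x, hTK hx, h⟩
    · exact ⟨-x, hK.1.neg_mem_iff.2 (hTK hx), by simpa using h⟩
  obtain ⟨x₀, hx₀, -⟩ := hKD d₀ hd₀
  have hcoe := continuous_coe_real_ereal
  have hmm := Sion.minimax' (X := K) (Y := D) (f := fun x d => ((-(d x) : ℝ) : EReal))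
    ⟨x₀, hx₀⟩ hK.2 hKc
    (fun d _ => (hcoe.comp (map_continuous d).neg).lowerSemicontinuous.lowerSemicontinuousOn _)
    (fun d _ => QuasiconvexOn.monotone_comp (g := Real.toEReal) EReal.coe_strictMono.monotone
      (d.toLinearMap.concaveOn hK.2).neg.quasiconvexOn)
    hc
    (fun x _ => (hcoe.comp (WeakDual.eval_continuous x).neg).upperSemicontinuous.upperSemicontinuousOn _)
    (fun x _ => QuasiconcaveOn.monotone_comp (g := Real.toEReal) EReal.coe_strictMono.monotone
      ((LinearMap.applyₗ x ∘ₗ ContinuousLinearMap.coeLM ℝ).convexOn hc).neg.quasiconcaveOn)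
  -- Weakening the bound `-1` to `-1/2` makes the inequality strict, so that some `x` realises it
  -- without the infimum having to be attained.
  have hlt : (⨅ x ∈ K, ⨆ d ∈ D, ((-(d x) : ℝ) : EReal)) < ((-(1 / 2) : ℝ) : EReal) := by
    rw [hmm]
    refine lt_of_le_of_lt (b := ((-1 : ℝ) : EReal)) (iSup₂_le fun d hd => ?_)
      (EReal.coe_lt_coe_iff.2 (by norm_num))
    obtain ⟨x, hx, h1⟩ := hKD d hd
    exact iInf₂_le_of_le x hx (EReal.coe_le_coe_iff.2 (by linarith))
  simp only [iInf_lt_iff] at hlt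
  obtain ⟨x, -, hx⟩ := hlt
  refine ⟨x, fun d hd => ?_⟩
  have := EReal.coe_le_coe_iff.1 ((le_iSup₂_of_le d hd le_rfl).trans hx.le)
  linarith

/-- **Krein–Šmulian** for separable preduals: a convex sequentially weak* closed set is weak*
closed. -/
theorem Convex.isClosed_of_isSeqClosed_weakDual [CompleteSpace E]
    [TopologicalSpace.SeparableSpace E] {C : Set (WeakDual ℝ E)} (hc : Convex ℝ C)
    (hC : IsSeqClosed C) : IsClosed C := by
  refine isClosed_of_closure_subset fun l hl => ?_
  by_contra hlC
  -- Translating by `l` moves the point to be separated to `0`. The resulting `h` puts `C` inside a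
  -- weak* closed half-space that omits `l`.
  set D : Set (WeakDual ℝ E) := (fun d => d + l) ⁻¹' C
  have hDc : Convex ℝ D := hc.translate_preimage_left l
  have hDs : IsSeqClosed D := fun u x hu hx => hC hu (hx.add_const l)
  obtain ⟨h, hh⟩ := exists_half_lt_of_isCompact_inter_closedBall hDc
    (isCompact_inter_closedBall_of_isSeqClosed hDs) (by simpa [D] using hlC)
  have hsub : C ⊆ {d | 1 / 2 + l h ≤ d h} := fun d hd => by
    have := hh (d - l) (by simpa [D] using hd)
    have e : (d - l) h = d h - l h := rfl
    simp only [Set.mem_ofPred_eq]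
    linarith
  have := closure_minimal hsub (isClosed_le continuous_const (WeakDual.eval_continuous h)) hl
  simp only [Set.mem_ofPred_eq] at this
  linarith

theorem isClosed_closure_seqTopology_weakDual [CompleteSpace E]
    [TopologicalSpace.SeparableSpace E] {S : Set (WeakDual ℝ E)}
    (hS : ∀ x ∈ S, ∀ y ∈ S, ∀ a b : ℝ, 0 < a → 0 < b → a + b = 1 →
      ∃ z : ℕ → WeakDual ℝ E, (∀ n, z n ∈ S) ∧ Tendsto z atTop (𝓝 (a • x + b • y))) :
    IsClosed (@closure _ (seqTopology inferInstance) S) :=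
  (convex_closure_seqTopology hS).isClosed_of_isSeqClosed_weakDual
    ((isClosed_seqTopology_iff _).1 (@isClosed_closure _ (seqTopology inferInstance) S))

end KreinSmulian

/-! ### The dual of `L^1` over a finite measure -/

section DualL1

variable {α E : Type*} [MeasurableSpace α] {μ : Measure α} [NormedAddCommGroup E]
  [InnerProductSpace ℝ E]

/-- The pairing of `L^∞` with `L^1`. -/
def lInfPairing (μ : Measure α) (E : Type*) [NormedAddCommGroup E] [InnerProductSpace ℝ E] :
    Lp E ∞ μ →L[ℝ] Lp E 1 μ →L[ℝ] ℝ :=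
  (innerSL ℝ).lpPairing μ ∞ 1

theorem lInfPairing_apply (g : Lp E ∞ μ) (p : Lp E 1 μ) :
    lInfPairing μ E g p = ∫ x, ⟪g x, p x⟫_ℝ ∂μ := by
  rw [lInfPairing, ContinuousLinearMap.lpPairing_eq_integral]
  rfl

/-- The inclusion L² → L¹ pulls functionals on L¹ back to a Hilbert space, where Riesz
representation applies. -/
theorem exists_clm_L2_L1 [IsFiniteMeasure μ] :
    ∃ J : Lp E 2 μ →L[ℝ] Lp E 1 μ, ∀ f, J f =ᵐ[μ] f := by
  have h12 : (1 : ℝ≥0∞) ≤ 2 := by norm_num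
  have hm : ∀ f : Lp E 2 μ, MemLp f 1 μ := fun f => (Lp.memLp f).mono_exponent h12
  let J : Lp E 2 μ →ₗ[ℝ] Lp E 1 μ :=
    { toFun := fun f => (hm f).toLp f
      map_add' := fun f g => by
        refine Lp.ext ?_
        filter_upwards [(hm (f + g)).coeFn_toLp, (hm f).coeFn_toLp, (hm g).coeFn_toLp,
          Lp.coeFn_add f g, Lp.coeFn_add ((hm f).toLp f) ((hm g).toLp g)] with x h1 h2 h3 h4 h5
        rw [h1, h4, h5, Pi.add_apply, Pi.add_apply, h2, h3]
      map_smul' := fun c f => by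
        refine Lp.ext ?_
        filter_upwards [(hm (c • f)).coeFn_toLp, (hm f).coeFn_toLp,
          Lp.coeFn_smul c f, Lp.coeFn_smul c ((hm f).toLp f)] with x h1 h2 h3 h4
        rw [h1, h3, RingHom.id_apply, h4, Pi.smul_apply, Pi.smul_apply, h2] }
  refine ⟨J.mkContinuous (μ Set.univ ^ (1 / (1 : ℝ≥0∞).toReal - 1 / (2 : ℝ≥0∞).toReal)).toReal
    fun f => ?_, fun f => (hm f).coeFn_toLp⟩
  change ‖(hm f).toLp f‖ ≤ _
  have hfin : μ Set.univ ^ (1 / (1 : ℝ≥0∞).toReal - 1 / (2 : ℝ≥0∞).toReal) ≠ ⊤ := by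
    refine ENNReal.rpow_ne_top_of_nonneg ?_ (measure_ne_top μ _)
    norm_num
  rw [Lp.norm_toLp, Lp.norm_def, mul_comm, ← ENNReal.toReal_mul]
  exact ENNReal.toReal_mono (ENNReal.mul_ne_top (Lp.eLpNorm_ne_top f) hfin)
    (eLpNorm_le_eLpNorm_mul_rpow_measure_univ h12 (Lp.aestronglyMeasurable f))

/-- The functional `p ↦ ∫ ⟪g, p⟫` is bounded on bounded functions by the `L^1` norm only if `g` is
bounded. -/
theorem ae_norm_le_of_forall_integral_inner_le [IsFiniteMeasure μ] {g : α → E}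
    (hg : MemLp g 2 μ) {M : ℝ}
    (h : ∀ s : Set α, MeasurableSet s →
      ∫ x, ⟪g x, s.indicator (fun x => ‖g x‖⁻¹ • g x) x⟫_ℝ ∂μ ≤ M * μ.real s) :
    ∀ᵐ x ∂μ, ‖g x‖ ≤ M := by
  refine ae_le_of_forall_setIntegral_le (hg.integrable (by norm_num)).norm (integrable_const M)
    fun s hs _ => ?_
  rw [setIntegral_const, smul_eq_mul, mul_comm, ← integral_indicator hs]
  refine le_trans (le_of_eq ?_) (h s hs)
  congr 1 with x
  by_cases hx : x ∈ s
  · simp only [Set.indicator_of_mem hx, real_inner_smul_right, real_inner_self_eq_norm_sq]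
    -- Where `g` vanishes, the convention `0⁻¹ = 0` makes both sides zero.
    by_cases h0 : ‖g x‖ = 0
    · simp [h0]
    · field_simp
  · simp [hx]

/-- Every continuous linear functional on `L^1` of a finite measure is given by an `L^∞` function. -/
theorem exists_lInfPairing_eq [CompleteSpace E] [IsFiniteMeasure μ] (l : Lp E 1 μ →L[ℝ] ℝ) :
    ∃ g : Lp E ∞ μ, lInfPairing μ E g = l := by
  obtain ⟨J, hJ⟩ := exists_clm_L2_L1 (μ := μ) (E := E)
  -- The Riesz representative of `l` on L². Testing it with its own normalisation on measurable sets
  -- bounds it by `‖l‖`; density of simple functions in L¹ then extends the representation to all of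
  -- L¹.
  set g₂ : Lp E 2 μ := (InnerProductSpace.toDual ℝ (Lp E 2 μ)).symm (l.comp J)
  have hg₂ : ∀ p : Lp E 2 μ, l (J p) = ∫ x, ⟪g₂ x, p x⟫_ℝ ∂μ := fun p => by
    rw [← L2.inner_def, InnerProductSpace.toDual_symm_apply]
    rfl
  have hbound : ∀ᵐ x ∂μ, ‖g₂ x‖ ≤ ‖l‖ := by
    refine ae_norm_le_of_forall_integral_inner_le (Lp.memLp g₂) fun s hs => ?_
    set q : α → E := s.indicator fun x => ‖g₂ x‖⁻¹ • g₂ x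
    have hle : ∀ x, ‖q x‖ ≤ s.indicator (fun _ => (1 : ℝ)) x := fun x => by
      by_cases hx : x ∈ s
      · simp only [q, Set.indicator_of_mem hx, norm_smul, norm_inv, norm_norm]
        exact inv_mul_le_one
      · simp [q, hx]
    have hqm : AEStronglyMeasurable q μ :=
      ((Lp.aestronglyMeasurable g₂).norm.inv₀.smul (Lp.aestronglyMeasurable g₂)).indicator hs
    have hqb : ∀ x, ‖q x‖ ≤ 1 := fun x => (hle x).trans (by
      by_cases hx : x ∈ s <;> simp [hx])
    have hq : MemLp q 2 μ := (memLp_top_of_bound hqm 1 (ae_of_all _ hqb)).mono_exponent le_top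
    have e1 : ∫ x, ⟪g₂ x, q x⟫_ℝ ∂μ = l (J (hq.toLp q)) := by
      rw [hg₂]
      refine integral_congr_ae ?_
      filter_upwards [hq.coeFn_toLp] with x hx
      rw [hx]
    rw [e1]
    refine (le_abs_self _).trans ((l.le_opNorm _).trans ?_)
    gcongr
    rw [L1.norm_eq_integral_norm, ← integral_indicator_one hs]
    refine integral_mono_ae (L1.integrable_coeFn _).norm
      ((integrable_const (1 : ℝ)).indicator hs) ?_
    filter_upwards [hJ (hq.toLp q), hq.coeFn_toLp] with x h1 h2
    rw [h1, h2]
    exact hle x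
  have hg : MemLp g₂ ∞ μ := memLp_top_of_bound (Lp.aestronglyMeasurable g₂) _ hbound
  refine ⟨hg.toLp g₂, ?_⟩
  ext p
  refine Lp.induction ENNReal.one_ne_top
    (fun p => lInfPairing μ E (hg.toLp g₂) p = l p) ?_ ?_ ?_ p
  · intro c s hs hμs
    have e : l (Lp.simpleFunc.indicatorConst 1 hs hμs.ne c : Lp E 1 μ)
        = l (J (indicatorConstLp 2 hs hμs.ne c)) := by
      congr 1
      refine Lp.ext ?_
      rw [Lp.simpleFunc.coe_indicatorConst]
      exact indicatorConstLp_coeFn.trans (indicatorConstLp_coeFn.symm.trans (hJ _).symm)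
    rw [e, hg₂, lInfPairing_apply, Lp.simpleFunc.coe_indicatorConst]
    refine integral_congr_ae ?_
    filter_upwards [hg.coeFn_toLp, indicatorConstLp_coeFn (p := 1) (hs := hs) (hμs := hμs.ne) (c := c),
      indicatorConstLp_coeFn (p := 2) (hs := hs) (hμs := hμs.ne) (c := c)] with x h1 h2 h3
    rw [h1, h2, h3]
  · intro f g hf hg' _ h1 h2
    rw [map_add, map_add, h1, h2]
  · exact isClosed_eq (ContinuousLinearMap.continuous _) l.continuous

/-- `L^1` separates the points of `L^∞`. -/
theorem lInfPairing_injective [IsFiniteMeasure μ] : Function.Injective (lInfPairing μ E) := by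
  rw [injective_iff_map_eq_zero]
  intro g hg
  have hg2 : MemLp g 2 μ := (Lp.memLp g).mono_exponent le_top
  have h1 : MemLp g 1 μ := (Lp.memLp g).mono_exponent le_top
  have := congrArg (fun l => l (h1.toLp g)) hg
  simp only [lInfPairing_apply, _root_.zero_apply] at this
  have h2 : ∫ x, ‖g x‖ ^ 2 ∂μ = 0 := by
    rw [← this]
    refine integral_congr_ae ?_
    filter_upwards [h1.coeFn_toLp] with x hx
    rw [hx, real_inner_self_eq_norm_sq]
  rw [integral_eq_zero_iff_of_nonneg (fun x => by positivity) hg2.norm.integrable_sq] at h2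
  refine (Lp.eq_zero_iff_ae_eq_zero).2 ?_
  filter_upwards [h2] with x hx
  simpa using hx

end DualL1

/-! ### The chain rule for weak gradients -/

section ChainRule

open scoped Convolution

variable {N : ℕ} {Ω : Set (EuclideanSpace ℝ (Fin N))} {u : EuclideanSpace ℝ (Fin N) → ℝ}
  {g : EuclideanSpace ℝ (Fin N) → EuclideanSpace ℝ (Fin N)}

theorem IsWeakGradient.congr_ae {u' : EuclideanSpace ℝ (Fin N) → ℝ}
    {g' : EuclideanSpace ℝ (Fin N) → EuclideanSpace ℝ (Fin N)} (h : IsWeakGradient Ω u g)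
    (hu : u =ᵐ[volume.restrict Ω] u') (hg : g =ᵐ[volume.restrict Ω] g') :
    IsWeakGradient Ω u' g' := by
  intro φ hφ hc hs v
  have h1 : ∫ x in Ω, u x * fderiv ℝ φ x v = ∫ x in Ω, u' x * fderiv ℝ φ x v :=
    integral_congr_ae (by filter_upwards [hu] with x hx; rw [hx])
  have h2 : ∫ x in Ω, ⟪g x, v⟫_ℝ * φ x = ∫ x in Ω, ⟪g' x, v⟫_ℝ * φ x :=
    integral_congr_ae (by filter_upwards [hg] with x hx; rw [hx])
  rw [← h1, ← h2]
  exact h φ hφ hc hs v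

/-- Test functions and their derivatives vanish off `Ω`, so everything can be integrated over the
whole space, where convolution lives. -/
theorem isWeakGradient_iff_integral :
    IsWeakGradient Ω u g ↔ ∀ φ : EuclideanSpace ℝ (Fin N) → ℝ, ContDiff ℝ ∞ φ →
      HasCompactSupport φ → tsupport φ ⊆ Ω → ∀ v : EuclideanSpace ℝ (Fin N),
      ∫ x, u x * fderiv ℝ φ x v = - ∫ x, ⟪g x, v⟫_ℝ * φ x := by
  refine forall_congr' fun φ => forall_congr' fun hφ => forall_congr' fun hc =>
    forall_congr' fun hs => forall_congr' fun v => ?_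
  have hd : ∀ x, x ∉ Ω → fderiv ℝ φ x = 0 := fun x hx =>
    image_eq_zero_of_notMem_tsupport fun h => hx (hs (tsupport_fderiv_subset ℝ h))
  have hz : ∀ x, x ∉ Ω → φ x = 0 := fun x hx =>
    image_eq_zero_of_notMem_tsupport fun h => hx (hs h)
  rw [setIntegral_eq_integral_of_forall_compl_eq_zero (fun x hx => by simp [hd x hx]),
    setIntegral_eq_integral_of_forall_compl_eq_zero (fun x hx => by simp [hz x hx])]

/-- Mollification commutes with weak differentiation away from the boundary. -/
theorem IsWeakGradient.fderiv_convolution (h : IsWeakGradient Ω u g)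
    (hu : LocallyIntegrable u) (hg : LocallyIntegrable g)
    (ρ : ContDiffBump (0 : EuclideanSpace ℝ (Fin N))) {x : EuclideanSpace ℝ (Fin N)}
    (hx : Metric.closedBall x ρ.rOut ⊆ Ω) (v : EuclideanSpace ℝ (Fin N)) :
    fderiv ℝ (ρ.normed volume ⋆[ContinuousLinearMap.lsmul ℝ ℝ, volume] u) x v
      = ⟪(ρ.normed volume ⋆[ContinuousLinearMap.lsmul ℝ ℝ, volume] g) x, v⟫_ℝ := by
  set r := ρ.normed (volume : Measure (EuclideanSpace ℝ (Fin N)))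
  have hrc : HasCompactSupport r := ρ.hasCompactSupport_normed
  have hrs : ContDiff ℝ ∞ r := ρ.contDiff_normed
  have hr1 : ContDiff ℝ 1 r := ρ.contDiff_normed
  rw [(hrc.hasFDerivAt_convolution_left _ hr1 hu x).fderiv, convolution_eq_swap,
    convolution_eq_swap]
  have i1 : Integrable (fun t => ((ContinuousLinearMap.lsmul ℝ ℝ).precompL
      (EuclideanSpace ℝ (Fin N))) (fderiv ℝ r (x - t)) (u t)) :=
    ((hrc.fderiv ℝ).convolutionExists_left _ (hr1.continuous_fderiv one_ne_zero) hu
      x).integrable_swap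
  have i2 : Integrable (fun t => (ContinuousLinearMap.lsmul ℝ ℝ) (r (x - t)) (g t)) :=
    (hrc.convolutionExists_left _ hr1.continuous hg x).integrable_swap
  rw [ContinuousLinearMap.integral_apply i1, real_inner_comm, ← integral_inner i2]
  have hts : tsupport (fun t => r (x - t)) ⊆ Metric.closedBall x ρ.rOut := by
    refine closure_minimal (fun t ht => ?_) Metric.isClosed_closedBall
    have : x - t ∈ Metric.ball (0 : EuclideanSpace ℝ (Fin N)) ρ.rOut := by
      rw [← ρ.support_normed_eq (μ := volume)]
      exact ht
    rw [Metric.mem_closedBall, dist_comm, dist_eq_norm]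
    simpa using (mem_ball_zero_iff.1 this).le
  -- The weak gradient is tested with the reflected kernel centred at `x`; the sign produced by the
  -- reflection cancels the one from integration by parts.
  have key := (isWeakGradient_iff_integral.1 h) (fun t => r (x - t))
    (hrs.comp (contDiff_const.sub contDiff_id))
    (HasCompactSupport.of_support_subset_isCompact (isCompact_closedBall x ρ.rOut)
      (subset_closure.trans hts)) (hts.trans hx) v
  have hfd : ∀ t, fderiv ℝ (fun t => r (x - t)) t v = - fderiv ℝ r (x - t) v := fun t => by
    have hd : HasFDerivAt r (fderiv ℝ r (x - t)) (x - t) :=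
      (hr1.differentiable one_ne_zero _).hasFDerivAt
    have := hd.comp t ((hasFDerivAt_id t).const_sub x)
    rw [show (fun t => r (x - t)) = r ∘ HSub.hSub x from rfl, this.fderiv]
    simp
  simp only [hfd, mul_neg, integral_neg, neg_inj] at key
  refine Eq.trans ?_ (key.trans ?_)
  · refine integral_congr_ae (Eventually.of_forall fun t => ?_)
    simp [ContinuousLinearMap.precompL_apply, mul_comm]
  · refine integral_congr_ae (Eventually.of_forall fun t => ?_)
    simp [real_inner_smul_right, real_inner_comm, mul_comm]

/-- The chain rule for weak gradients and `C^1` outer functions. -/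
theorem IsWeakGradient.comp_of_continuous_deriv (hΩ : IsOpen Ω) (h : IsWeakGradient Ω u g)
    (hum : Measurable u) {M : ℝ} (hu : ∀ x, ‖u x‖ ≤ M) (hgm : Measurable g) {M' : ℝ}
    (hg : ∀ x, ‖g x‖ ≤ M') {φ φ' : ℝ → ℝ} (hφ : ∀ s, HasDerivAt φ (φ' s) s)
    (hφ' : Continuous φ') :
    IsWeakGradient Ω (fun x => φ (u x)) (fun x => φ' (u x) • g x) := by
  have hM : 0 ≤ M := (norm_nonneg _).trans (hu 0)
  have hM' : 0 ≤ M' := (norm_nonneg _).trans (hg 0)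
  have hul : LocallyIntegrable u :=
    (memLp_top_of_bound hum.aestronglyMeasurable M (ae_of_all _ hu)).locallyIntegrable le_top
  have hgl : LocallyIntegrable g :=
    (memLp_top_of_bound hgm.aestronglyMeasurable M' (ae_of_all _ hg)).locallyIntegrable le_top
  rw [isWeakGradient_iff_integral]
  intro ζ hζ hc hs v
  have hφc : Continuous φ := continuous_iff_continuousAt.2 fun s => (hφ s).continuousAt
  have hφ1 : ContDiff ℝ 1 φ := by
    rw [contDiff_one_iff_deriv]
    refine ⟨fun s => (hφ s).differentiableAt, ?_⟩
    rwa [show deriv φ = φ' from funext fun s => (hφ s).deriv]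
  obtain ⟨C, hC⟩ := (isCompact_Icc (a := -M) (b := M)).exists_bound_of_continuousOn hφc.continuousOn
  obtain ⟨C', hC'⟩ :=
    (isCompact_Icc (a := -M) (b := M)).exists_bound_of_continuousOn hφ'.continuousOn
  -- A fixed ratio 2 of outer to inner radius is what the almost everywhere convergence of the
  -- mollifications asks for (`K := 2`).
  let ρ : ℕ → ContDiffBump (0 : EuclideanSpace ℝ (Fin N)) := fun i =>
    ⟨1 / (i + 1), 2 * (1 / (i + 1)), by positivity,
      by linarith [show (0 : ℝ) < 1 / (i + 1) by positivity]⟩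
  have hρ : Tendsto (fun i => (ρ i).rOut) atTop (𝓝 0) := by
    simpa [ρ] using (tendsto_one_div_add_atTop_nhds_zero_nat (𝕜 := ℝ)).const_mul 2
  let U : ℕ → EuclideanSpace ℝ (Fin N) → ℝ := fun i =>
    (ρ i).normed volume ⋆[ContinuousLinearMap.lsmul ℝ ℝ, volume] u
  let G : ℕ → EuclideanSpace ℝ (Fin N) → EuclideanSpace ℝ (Fin N) := fun i =>
    (ρ i).normed volume ⋆[ContinuousLinearMap.lsmul ℝ ℝ, volume] g
  have hUt : ∀ᵐ x, Tendsto (fun i => U i x) atTop (𝓝 (u x)) :=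
    ContDiffBump.ae_convolution_tendsto_right_of_locallyIntegrable hρ (K := 2)
      (Eventually.of_forall fun i => le_rfl) hul
  have hGt : ∀ᵐ x, Tendsto (fun i => G i x) atTop (𝓝 (g x)) :=
    ContDiffBump.ae_convolution_tendsto_right_of_locallyIntegrable hρ (K := 2)
      (Eventually.of_forall fun i => le_rfl) hgl
  have hUb : ∀ i x, ‖U i x‖ ≤ M := fun i x => by
    have := dist_convolution_le (μ := volume) (x₀ := x) (z₀ := (0 : ℝ)) hM
      (ρ i).support_normed_eq.subset (ρ i).nonneg_normed (ρ i).integral_normed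
      hum.aestronglyMeasurable (fun y _ => by simpa using hu y)
    simpa using this
  have hGb : ∀ i x, ‖G i x‖ ≤ M' := fun i x => by
    have := dist_convolution_le (μ := volume) (x₀ := x) (z₀ := (0 : EuclideanSpace ℝ (Fin N))) hM'
      (ρ i).support_normed_eq.subset (ρ i).nonneg_normed (ρ i).integral_normed
      hgm.aestronglyMeasurable (fun y _ => by simpa using hg y)
    simpa using this
  have hUs : ∀ i, ContDiff ℝ 1 (U i) := fun i =>
    (ρ i).hasCompactSupport_normed.contDiff_convolution_left _ (ρ i).contDiff_normed hul
  have hGs : ∀ i, Continuous (G i) := fun i =>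
    (ρ i).hasCompactSupport_normed.continuous_convolution_left _ (ρ i).continuous_normed hgl
  have hmem : ∀ {s : ℝ}, ‖s‖ ≤ M → s ∈ Set.Icc (-M) M := fun hs => abs_le.1 hs
  have hcont : Continuous (fun x => fderiv ℝ ζ x v) :=
    (hζ.continuous_fderiv (by simp)).clm_apply continuous_const
  have hint : Integrable (fun x => fderiv ℝ ζ x v) :=
    hcont.integrable_of_hasCompactSupport (hc.fderiv_apply (𝕜 := ℝ) v)
  have hintζ : Integrable ζ := hζ.continuous.integrable_of_hasCompactSupport hc
  have lim1 : Tendsto (fun i => ∫ x, φ (U i x) * fderiv ℝ ζ x v) atTop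
      (𝓝 (∫ x, φ (u x) * fderiv ℝ ζ x v)) := by
    refine tendsto_integral_of_dominated_convergence (fun x => C * ‖fderiv ℝ ζ x v‖)
      (fun i => ((hφc.comp (hUs i).continuous).mul hcont).aestronglyMeasurable)
      (hint.norm.const_mul C) (fun i => ae_of_all _ fun x => ?_) ?_
    · rw [norm_mul]
      gcongr
      exact hC _ (hmem (hUb i x))
    · filter_upwards [hUt] with x hx
      exact ((hφc.tendsto _).comp hx).mul_const _
  have lim2 : Tendsto (fun i => ∫ x, ⟪φ' (U i x) • G i x, v⟫_ℝ * ζ x) atTop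
      (𝓝 (∫ x, ⟪φ' (u x) • g x, v⟫_ℝ * ζ x)) := by
    refine tendsto_integral_of_dominated_convergence (fun x => C' * M' * ‖v‖ * ‖ζ x‖)
      (fun i => Continuous.aestronglyMeasurable (Continuous.mul (Continuous.inner
        ((hφ'.comp (hUs i).continuous).smul (hGs i)) continuous_const) hζ.continuous))
      (hintζ.norm.const_mul _) (fun i => ae_of_all _ fun x => ?_) ?_
    · rw [norm_mul]
      gcongr
      refine (norm_inner_le_norm _ _).trans ?_
      rw [norm_smul]
      have h1 := hC' _ (hmem (hUb i x))
      have h2 := hGb i x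
      have h3 : 0 ≤ C' := (norm_nonneg _).trans h1
      gcongr
    · filter_upwards [hUt, hGt] with x hx hgx
      exact ((((hφ'.tendsto _).comp hx).smul hgx).inner tendsto_const_nhds).mul_const _
  -- Once the mollification radius is below `δ`, the balls around points of the support of `ζ` stay
  -- in `Ω`, and the classical chain rule applies to `U i` there.
  obtain ⟨δ, hδ, hδΩ⟩ := hc.isCompact.exists_cthickening_subset_open hΩ hs
  have hev : ∀ᶠ i in atTop, ∫ x, φ (U i x) * fderiv ℝ ζ x v
      = - ∫ x, ⟪φ' (U i x) • G i x, v⟫_ℝ * ζ x := by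
    filter_upwards [hρ.eventually (gt_mem_nhds hδ)] with i hi
    have hφU : ContDiff ℝ 1 (fun x => φ (U i x)) := hφ1.comp (hUs i)
    have hφUd := hφU.differentiable one_ne_zero
    have hφUc : Continuous fun x => fderiv ℝ (fun x => φ (U i x)) x v :=
      (hφU.continuous_fderiv one_ne_zero).clm_apply continuous_const
    rw [integral_mul_fderiv_eq_neg_fderiv_mul_of_integrable (μ := volume)
      (f := fun x => φ (U i x)) (g := ζ) (v := v)
      ((hφUc.mul hζ.continuous).integrable_of_hasCompactSupport hc.mul_left)
      ((hφU.continuous.mul hcont).integrable_of_hasCompactSupport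
        ((hc.fderiv_apply (𝕜 := ℝ) v).mul_left))
      ((hφU.continuous.mul hζ.continuous).integrable_of_hasCompactSupport hc.mul_left)
      (fun x _ => hφUd x) (fun x _ => hζ.differentiable (by simp) x)]
    congr 1
    refine integral_congr_ae (Eventually.of_forall fun x => ?_)
    by_cases hx : x ∈ tsupport ζ
    · have hball : Metric.closedBall x (ρ i).rOut ⊆ Ω :=
        (Metric.closedBall_subset_closedBall hi.le).trans
          ((Metric.closedBall_subset_cthickening hx δ).trans hδΩ)
      have hfd := h.fderiv_convolution hul hgl (ρ i) hball v
      have hcomp := (hφ (U i x)).comp_hasFDerivAt x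
        ((hUs i).differentiable one_ne_zero x).hasFDerivAt
      dsimp only
      rw [show (fun x => φ (U i x)) = φ ∘ U i from rfl, hcomp.fderiv, real_inner_smul_left,
        _root_.smul_apply, smul_eq_mul]
      congr 2
    · simp [image_eq_zero_of_notMem_tsupport hx]
  exact tendsto_nhds_unique (lim1.congr' hev) lim2.neg

/-- The chain rule for weak gradients and Lipschitz outer functions with right derivatives. -/
theorem IsWeakGradient.comp_of_hasDerivWithinAt_Ioi (hΩ : IsOpen Ω) (h : IsWeakGradient Ω u g)
    (hum : Measurable u) {M : ℝ} (hu : ∀ x, ‖u x‖ ≤ M) (hgm : Measurable g) {M' : ℝ}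
    (hg : ∀ x, ‖g x‖ ≤ M') {φ ψ : ℝ → ℝ} {L : NNReal} (hL : LipschitzWith L φ)
    (hφ : ∀ s, HasDerivWithinAt φ (ψ s) (Set.Ioi s) s) :
    IsWeakGradient Ω (fun x => φ (u x)) (fun x => ψ (u x) • g x) := by
  have hM : 0 ≤ M := (norm_nonneg _).trans (hu 0)
  have hφc : Continuous φ := hL.continuous
  -- The interval reaches `M + 1` because the averages below look ahead by at most 1.
  obtain ⟨C, hC⟩ :=
    (isCompact_Icc (a := -M) (b := M + 1)).exists_bound_of_continuousOn hφc.continuousOn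
  let Φ : ℝ → ℝ := fun s => ∫ t in (0 : ℝ)..s, φ t
  have hΦ : ∀ s, HasDerivAt Φ (φ s) s := fun s => hφc.integral_hasStrictDerivAt 0 s |>.hasDerivAt
  let τ : ℕ → ℝ := fun j => 1 / (j + 1)
  have hτ0 : ∀ j, 0 < τ j := fun j => by positivity
  have hτ1 : ∀ j, τ j ≤ 1 := fun j => by
    rw [div_le_one (by positivity)]
    linarith [(Nat.cast_nonneg j : (0 : ℝ) ≤ j)]
  have hτ : ∀ s, Tendsto (fun j => s + τ j) atTop (𝓝[>] s) := fun s => by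
    refine tendsto_nhdsWithin_iff.2 ⟨?_, Eventually.of_forall fun j => by simpa using hτ0 j⟩
    simpa [τ] using (tendsto_one_div_add_atTop_nhds_zero_nat (𝕜 := ℝ)).const_add s
  -- Forward averages of `φ` over `[s, s + τ j]`. They are C¹, and their derivatives are forward
  -- difference quotients, bounded by `L` and converging to `ψ` at every point; no exceptional set
  -- of kinks has to be pulled back through `u`.
  let P : ℕ → ℝ → ℝ := fun j s => (τ j)⁻¹ * (Φ (s + τ j) - Φ s)
  let P' : ℕ → ℝ → ℝ := fun j s => (τ j)⁻¹ * (φ (s + τ j) - φ s)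
  have hP : ∀ j s, HasDerivAt (P j) (P' j s) s := fun j s =>
    (((hΦ (s + τ j)).comp_add_const s (τ j)).sub (hΦ s)).const_mul _
  have hP'c : ∀ j, Continuous (P' j) := fun j => by fun_prop
  have hPc : ∀ j, Continuous (P j) := fun j =>
    continuous_iff_continuousAt.2 fun s => (hP j s).continuousAt
  have hPt : ∀ s, Tendsto (fun j => P j s) atTop (𝓝 (φ s)) := fun s => by
    have := ((hasDerivWithinAt_iff_tendsto_slope' (by simp)).1
      ((hΦ s).hasDerivWithinAt (s := Set.Ioi s))).comp (hτ s)
    refine this.congr fun j => ?_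
    simp [P, slope]
  have hP't : ∀ s, Tendsto (fun j => P' j s) atTop (𝓝 (ψ s)) := fun s => by
    have := ((hasDerivWithinAt_iff_tendsto_slope' (by simp)).1 (hφ s)).comp (hτ s)
    refine this.congr fun j => ?_
    simp [P', slope]
  have hP'b : ∀ j s, ‖P' j s‖ ≤ L := fun j s => by
    have h1 := hL.dist_le_mul (s + τ j) s
    rw [dist_eq_norm, dist_eq_norm, add_sub_cancel_left, Real.norm_of_nonneg (hτ0 j).le] at h1
    rw [norm_mul, norm_inv, Real.norm_of_nonneg (hτ0 j).le, inv_mul_le_iff₀ (hτ0 j)]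
    linarith
  have hPb : ∀ j s, ‖s‖ ≤ M → ‖P j s‖ ≤ C := fun j s hs => by
    have hs' := abs_le.1 hs
    have h1 : Φ (s + τ j) - Φ s = ∫ t in s..(s + τ j), φ t :=
      intervalIntegral.integral_interval_sub_left (hφc.intervalIntegrable _ _)
        (hφc.intervalIntegrable _ _)
    have h2 : ‖∫ t in s..(s + τ j), φ t‖ ≤ C * |s + τ j - s| := by
      refine intervalIntegral.norm_integral_le_of_norm_le_const fun t ht => ?_
      rw [Set.uIoc_of_le (by linarith [hτ0 j])] at ht
      exact hC t ⟨by linarith [ht.1], by linarith [ht.2, hτ1 j]⟩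
    rw [add_sub_cancel_left, abs_of_pos (hτ0 j)] at h2
    rw [norm_mul, norm_inv, Real.norm_of_nonneg (hτ0 j).le, inv_mul_le_iff₀ (hτ0 j), h1]
    linarith
  rw [isWeakGradient_iff_integral]
  intro ζ hζ hc hs v
  have hcont : Continuous (fun x => fderiv ℝ ζ x v) :=
    (hζ.continuous_fderiv (by simp)).clm_apply continuous_const
  have hint : Integrable (fun x => fderiv ℝ ζ x v) :=
    hcont.integrable_of_hasCompactSupport (hc.fderiv_apply (𝕜 := ℝ) v)
  have hintζ : Integrable ζ := hζ.continuous.integrable_of_hasCompactSupport hc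
  have lim1 : Tendsto (fun j => ∫ x, P j (u x) * fderiv ℝ ζ x v) atTop
      (𝓝 (∫ x, φ (u x) * fderiv ℝ ζ x v)) := by
    refine tendsto_integral_of_dominated_convergence (fun x => C * ‖fderiv ℝ ζ x v‖)
      (fun j => ((hPc j).measurable.comp hum).aestronglyMeasurable.mul hcont.aestronglyMeasurable)
      (hint.norm.const_mul C) (fun j => ae_of_all _ fun x => ?_)
      (ae_of_all _ fun x => (hPt (u x)).mul_const _)
    rw [norm_mul]
    gcongr
    exact hPb j _ (hu x)
  have lim2 : Tendsto (fun j => ∫ x, ⟪P' j (u x) • g x, v⟫_ℝ * ζ x) atTop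
      (𝓝 (∫ x, ⟪ψ (u x) • g x, v⟫_ℝ * ζ x)) := by
    refine tendsto_integral_of_dominated_convergence (fun x => L * M' * ‖v‖ * ‖ζ x‖)
      (fun j => ((((hP'c j).measurable.comp hum).aestronglyMeasurable.smul
        hgm.aestronglyMeasurable).inner aestronglyMeasurable_const).mul
          hζ.continuous.aestronglyMeasurable)
      (hintζ.norm.const_mul _) (fun j => ae_of_all _ fun x => ?_)
      (ae_of_all _ fun x =>
        (((hP't (u x)).smul tendsto_const_nhds).inner tendsto_const_nhds).mul_const _)
    rw [norm_mul]
    gcongr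
    refine (norm_inner_le_norm _ _).trans ?_
    rw [norm_smul]
    have h1 := hP'b j (u x)
    have h2 := hg x
    gcongr
  exact tendsto_nhds_unique (lim1.congr fun j => isWeakGradient_iff_integral.1
    (h.comp_of_continuous_deriv hΩ hum hu hgm hg (hP j) (hP'c j)) ζ hζ hc hs v) lim2.neg

/-- Provides the representatives, measurable and bounded at every point, to which the chain rule
above applies. -/
theorem exists_measurable_bounded_ae_eq {α F : Type*} [MeasurableSpace α] {μ : Measure α}
    [NormedAddCommGroup F] [MeasurableSpace F] [BorelSpace F] (f : Lp F ∞ μ) :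
    ∃ f' : α → F, Measurable f' ∧ (∀ x, ‖f' x‖ ≤ ‖f‖) ∧ f' =ᵐ[μ] f := by
  classical
  have hm : Measurable f := (Lp.stronglyMeasurable f).measurable
  refine ⟨fun x => if ‖f x‖ ≤ ‖f‖ then f x else 0,
    Measurable.ite ((Lp.stronglyMeasurable f).norm.measurable measurableSet_Iic) hm measurable_const,
    fun x => ?_, ?_⟩
  · dsimp only
    split_ifs with h
    · exact h
    · simp
  · filter_upwards [ae_le_eLpNormEssSup (f := f) (μ := μ)] with x hx
    refine if_pos ?_
    rw [Lp.norm_def, eLpNorm_exponent_top, ← toReal_enorm]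
    exact ENNReal.toReal_mono (by simpa using Lp.eLpNorm_ne_top f) hx

/-- The chain rule in `W^{1,∞}(Ω)`. -/
theorem W1inf.exists_comp (hΩ : IsOpen Ω) (w : W1inf Ω) {φ ψ : ℝ → ℝ} {L : NNReal}
    (hL : LipschitzWith L φ) (hφ : ∀ s, HasDerivWithinAt φ (ψ s) (Set.Ioi s) s)
    (hψm : Measurable ψ) (hψ : ∀ s, ‖ψ s‖ ≤ 1) :
    ∃ z : W1inf Ω, (∀ᵐ x ∂volume.restrict Ω, W1inf.fn z x = φ (W1inf.fn w x)) ∧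
      ∀ᵐ x ∂volume.restrict Ω, W1inf.grad z x = ψ (W1inf.fn w x) • W1inf.grad w x := by
  obtain ⟨u, hum, hu, huw⟩ := exists_measurable_bounded_ae_eq (W1inf.fn w)
  obtain ⟨g, hgm, hg, hgw⟩ := exists_measurable_bounded_ae_eq (W1inf.grad w)
  have h : IsWeakGradient Ω u g := IsWeakGradient.congr_ae w.2 huw.symm hgw.symm
  have h' := h.comp_of_hasDerivWithinAt_Ioi hΩ hum hu hgm hg hL hφ
  obtain ⟨C, hC⟩ := (isCompact_Icc (a := -‖W1inf.fn w‖)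
    (b := ‖W1inf.fn w‖)).exists_bound_of_continuousOn hL.continuous.continuousOn
  have m1 : MemLp (fun x => φ (u x)) ∞ (volume.restrict Ω) :=
    memLp_top_of_bound (hL.continuous.measurable.comp hum).aestronglyMeasurable C
      (ae_of_all _ fun x => hC _ (abs_le.1 (hu x)))
  have m2 : MemLp (fun x => ψ (u x) • g x) ∞ (volume.restrict Ω) :=
    memLp_top_of_bound ((hψm.comp hum).aestronglyMeasurable.smul hgm.aestronglyMeasurable)
      (1 * ‖W1inf.grad w‖) (ae_of_all _ fun x => by
        rw [norm_smul]
        exact mul_le_mul (hψ _) (hg x) (norm_nonneg _) zero_le_one)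
  refine ⟨⟨(m1.toLp _, m2.toLp _), h'.congr_ae m1.coeFn_toLp.symm m2.coeFn_toLp.symm⟩, ?_, ?_⟩
  · filter_upwards [m1.coeFn_toLp, huw] with x h1 h2
    rw [← h2]
    exact h1
  · filter_upwards [m2.coeFn_toLp, huw, hgw] with x h1 h2 h3
    rw [← h2, ← h3]
    exact h1

end ChainRule

/-! ### The weak* topology of `W^{1,∞}(Ω)` through the weak dual of `L^1 × L^1` -/

section WeakStar

variable {N : ℕ} {Ω : Set (EuclideanSpace ℝ (Fin N))}

theorem lInfPairing_smul_apply {α E : Type*} [MeasurableSpace α] {μ : Measure α}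
    [NormedAddCommGroup E] [InnerProductSpace ℝ E] (c : ℝ) (g : Lp E ∞ μ) (p : Lp E 1 μ) :
    lInfPairing μ E (c • g) p = c * lInfPairing μ E g p := by
  rw [ContinuousLinearMap.map_smul]
  rfl

theorem separableSpace_lp_one {α E : Type*} [MeasurableSpace α] {μ : Measure α}
    [NormedAddCommGroup E] [TopologicalSpace.SeparableSpace E] [IsSeparable μ] :
    TopologicalSpace.SeparableSpace (Lp E 1 μ) := by
  have : Fact ((1 : ℝ≥0∞) ≠ ⊤) := ⟨ENNReal.one_ne_top⟩
  infer_instance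

/-- The embedding of `W^{1,∞}(Ω)` into the weak dual of `L^1(Ω) × L^1(Ω; ℝ^N)`. -/
def W1inf.toDual (Ω : Set (EuclideanSpace ℝ (Fin N))) :
    W1inf Ω →ₗ[ℝ] WeakDual ℝ (Lp ℝ 1 (volume.restrict Ω) ×
      Lp (EuclideanSpace ℝ (Fin N)) 1 (volume.restrict Ω)) where
  toFun w := StrongDual.toWeakDual
    ((lInfPairing (volume.restrict Ω) ℝ (W1inf.fn w)).coprod
      (lInfPairing (volume.restrict Ω) (EuclideanSpace ℝ (Fin N)) (W1inf.grad w)))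
  map_add' w z := by
    refine DFunLike.ext _ _ fun p => ?_
    change lInfPairing _ ℝ (W1inf.fn w + W1inf.fn z) p.1
      + lInfPairing _ _ (W1inf.grad w + W1inf.grad z) p.2
      = (lInfPairing _ ℝ (W1inf.fn w) p.1 + lInfPairing _ _ (W1inf.grad w) p.2)
        + (lInfPairing _ ℝ (W1inf.fn z) p.1 + lInfPairing _ _ (W1inf.grad z) p.2)
    rw [map_add, map_add, _root_.add_apply, _root_.add_apply]
    ring
  map_smul' c w := by
    refine DFunLike.ext _ _ fun p => ?_
    exact (congrArg₂ (· + ·) (lInfPairing_smul_apply c (W1inf.fn w) p.1)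
      (lInfPairing_smul_apply c (W1inf.grad w) p.2)).trans (mul_add _ _ _).symm

theorem W1inf.toDual_apply (w : W1inf Ω) (p : Lp ℝ 1 (volume.restrict Ω) ×
      Lp (EuclideanSpace ℝ (Fin N)) 1 (volume.restrict Ω)) :
    W1inf.toDual Ω w p = lInfPairing _ ℝ (W1inf.fn w) p.1
      + lInfPairing _ _ (W1inf.grad w) p.2 := rfl

theorem lInfPairing_real_apply {α : Type*} [MeasurableSpace α] {μ : Measure α} (g : Lp ℝ ∞ μ)
    (p : Lp ℝ 1 μ) : lInfPairing μ ℝ g p = ∫ x, g x * p x ∂μ := by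
  rw [lInfPairing_apply]
  refine integral_congr_ae (Eventually.of_forall fun x => ?_)
  simp [mul_comm]

theorem W1inf.weakStar_eq_induced (Ω : Set (EuclideanSpace ℝ (Fin N))) :
    W1inf.weakStar Ω = TopologicalSpace.induced (W1inf.toDual Ω) inferInstance := by
  have h : (inferInstance : TopologicalSpace (WeakDual ℝ (Lp ℝ 1 (volume.restrict Ω) ×
      Lp (EuclideanSpace ℝ (Fin N)) 1 (volume.restrict Ω))))
      = TopologicalSpace.induced (fun l p => l p) Pi.topologicalSpace := rfl
  rw [h, induced_compose, W1inf.weakStar]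
  congr 1
  funext w p
  simp only [Function.comp_apply, W1inf.toDual_apply, lInfPairing_real_apply]
  rw [lInfPairing_apply]

theorem W1inf.tendsto_weakStar_iff {w : ℕ → W1inf Ω} {z : W1inf Ω} :
    Tendsto w atTop (@nhds _ (W1inf.weakStar Ω) z) ↔
      Tendsto (fun n => W1inf.toDual Ω (w n)) atTop (𝓝 (W1inf.toDual Ω z)) := by
  rw [W1inf.weakStar_eq_induced, nhds_induced, tendsto_comap_iff]
  rfl

theorem W1inf.continuous_toDual (Ω : Set (EuclideanSpace ℝ (Fin N))) :
    @Continuous _ _ (W1inf.weakStar Ω) _ (W1inf.toDual Ω) := by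
  rw [W1inf.weakStar_eq_induced]
  exact continuous_induced_dom

/-- The function determines its gradient, so pairings with the first factor alone identify weak*
limits. -/
theorem W1inf.eq_of_toDual_apply_eq [IsFiniteMeasure (volume.restrict Ω)] (hΩ : IsOpen Ω)
    {w z : W1inf Ω} (h : ∀ p, W1inf.toDual Ω w (p, 0) = W1inf.toDual Ω z (p, 0)) : w = z := by
  refine weakGradient_unique hΩ (lInfPairing_injective ?_)
  ext p
  simpa [W1inf.toDual_apply] using h p

/-- `W^{1,∞}(Ω)` is weak* closed. -/
theorem W1inf.exists_toDual_eq_of_tendsto [IsFiniteMeasure (volume.restrict Ω)]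
    {w : ℕ → W1inf Ω} {l : WeakDual ℝ (Lp ℝ 1 (volume.restrict Ω) ×
      Lp (EuclideanSpace ℝ (Fin N)) 1 (volume.restrict Ω))}
    (h : Tendsto (fun n => W1inf.toDual Ω (w n)) atTop (𝓝 l)) :
    ∃ z : W1inf Ω, W1inf.toDual Ω z = l := by
  obtain ⟨u, hu⟩ := exists_lInfPairing_eq
    ((WeakDual.toStrongDual l).comp (ContinuousLinearMap.inl ℝ _ _))
  obtain ⟨g, hg⟩ := exists_lInfPairing_eq
    ((WeakDual.toStrongDual l).comp (ContinuousLinearMap.inr ℝ _ _))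
  have hl : ∀ p, l p = lInfPairing _ ℝ u p.1 + lInfPairing _ _ g p.2 := fun p => by
    rw [hu, hg]
    change l p = l (p.1, 0) + l (0, p.2)
    rw [← map_add]
    simp
  suffices hw : IsWeakGradient Ω u g by
    refine ⟨⟨(u, g), hw⟩, ?_⟩
    refine DFunLike.ext _ _ fun p => ?_
    exact (hl p).symm
  intro φ hφ hc hs v
  have hcont : Continuous (fun x => fderiv ℝ φ x v) :=
    (hφ.continuous_fderiv (by simp)).clm_apply continuous_const
  have m1 : MemLp (fun x => fderiv ℝ φ x v) 1 (volume.restrict Ω) := memLp_one_iff_integrable.2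
    (hcont.integrable_of_hasCompactSupport (hc.fderiv_apply (𝕜 := ℝ) v)).restrict
  have m2 : MemLp (fun x => φ x • v) 1 (volume.restrict Ω) := memLp_one_iff_integrable.2
    (((hφ.continuous.integrable_of_hasCompactSupport hc).restrict).smul_const v)
  -- The weak gradient identity for `φ` and `v` says that the pairing with (∂ᵥφ, φ v) in L¹ × L¹ is
  -- zero, a condition that survives weak* limits.
  have key : ∀ (u : Lp ℝ ∞ (volume.restrict Ω))
      (g : Lp (EuclideanSpace ℝ (Fin N)) ∞ (volume.restrict Ω)),
      lInfPairing _ ℝ u (m1.toLp _) + lInfPairing _ _ g (m2.toLp _)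
        = (∫ x in Ω, u x * fderiv ℝ φ x v) + ∫ x in Ω, ⟪g x, v⟫_ℝ * φ x := fun u g => by
    rw [lInfPairing_real_apply, lInfPairing_apply]
    congr 1
    · refine integral_congr_ae ?_
      filter_upwards [m1.coeFn_toLp] with x hx
      rw [hx]
    · refine integral_congr_ae ?_
      filter_upwards [m2.coeFn_toLp] with x hx
      rw [hx, real_inner_smul_right, mul_comm]
  have h0 : ∀ n, W1inf.toDual Ω (w n) (m1.toLp _, m2.toLp _) = 0 := fun n => by
    rw [W1inf.toDual_apply, key]
    have : ∫ x in Ω, W1inf.fn (w n) x * fderiv ℝ φ x v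
        = -∫ x in Ω, ⟪W1inf.grad (w n) x, v⟫_ℝ * φ x := (w n).2 φ hφ hc hs v
    rw [this, neg_add_cancel]
  have hlim := ((WeakDual.eval_continuous (m1.toLp _, m2.toLp _)).tendsto l).comp h
  have hl0 : l (m1.toLp _, m2.toLp _) = 0 :=
    tendsto_nhds_unique hlim (by simp only [Function.comp_def, h0]; exact tendsto_const_nhds)
  rw [hl, key] at hl0
  exact eq_neg_of_add_eq_zero_left hl0

theorem W1inf.norm_toDual_le (w : W1inf Ω) :
    ‖WeakDual.toStrongDual (W1inf.toDual Ω w)‖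
      ≤ ‖lInfPairing (volume.restrict Ω) ℝ‖ * ‖W1inf.fn w‖
        + ‖lInfPairing (volume.restrict Ω) (EuclideanSpace ℝ (Fin N))‖ * ‖W1inf.grad w‖ := by
  refine ContinuousLinearMap.opNorm_le_bound _ (by positivity) fun p => ?_
  change ‖lInfPairing _ ℝ (W1inf.fn w) p.1 + lInfPairing _ _ (W1inf.grad w) p.2‖ ≤ _
  refine (norm_add_le _ _).trans ?_
  rw [add_mul]
  refine add_le_add ?_ ?_
  · refine (ContinuousLinearMap.le_opNorm₂ _ _ _).trans ?_
    gcongr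
    exact norm_fst_le p
  · refine (ContinuousLinearMap.le_opNorm₂ _ _ _).trans ?_
    gcongr
    exact norm_snd_le p

/-- Bounded sequences in `W^{1,∞}(Ω)` converge weak* as soon as the functions converge weak*. -/
theorem W1inf.tendsto_toDual_of_bounded [IsFiniteMeasure (volume.restrict Ω)] (hΩ : IsOpen Ω)
    {w : ℕ → W1inf Ω} {z : W1inf Ω} {R R' : ℝ} (hR : ∀ n, ‖W1inf.fn (w n)‖ ≤ R)
    (hR' : ∀ n, ‖W1inf.grad (w n)‖ ≤ R')
    (h : ∀ p, Tendsto (fun n => W1inf.toDual Ω (w n) (p, 0)) atTop (𝓝 (W1inf.toDual Ω z (p, 0)))) :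
    Tendsto (fun n => W1inf.toDual Ω (w n)) atTop (𝓝 (W1inf.toDual Ω z)) := by
  have := separableSpace_lp_one (E := ℝ) (μ := volume.restrict Ω)
  have := separableSpace_lp_one (E := EuclideanSpace ℝ (Fin N)) (μ := volume.restrict Ω)
  -- Every subsequence has a weak* convergent further subsequence by sequential Banach–Alaoglu; its
  -- limit comes from W^{1,∞}(Ω) and is identified with `z` by its function part.
  refine tendsto_of_subseq_tendsto fun ns hns => ?_
  obtain ⟨l, -, ms, hms, hl⟩ := WeakDual.isSeqCompact_closedBall ℝ _ (0 : StrongDual ℝ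
      (Lp ℝ 1 (volume.restrict Ω) × Lp (EuclideanSpace ℝ (Fin N)) 1 (volume.restrict Ω)))
    (‖lInfPairing (volume.restrict Ω) ℝ‖ * R
        + ‖lInfPairing (volume.restrict Ω) (EuclideanSpace ℝ (Fin N))‖ * R')
    (x := fun n => W1inf.toDual Ω (w (ns n))) (fun n => by
      rw [Set.mem_preimage, mem_closedBall_zero_iff]
      refine (W1inf.norm_toDual_le _).trans ?_
      gcongr
      · exact hR _
      · exact hR' _)
  obtain ⟨z', rfl⟩ := W1inf.exists_toDual_eq_of_tendsto (w := fun n => w (ns (ms n))) hl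
  have hz : z' = z := W1inf.eq_of_toDual_apply_eq hΩ fun p => tendsto_nhds_unique
    (((WeakDual.eval_continuous (p, 0)).tendsto _).comp hl)
    ((h p).comp (hns.comp hms.tendsto_atTop))
  exact ⟨ms, hz ▸ hl⟩

/-- Transfers closures between W^{1,∞}(Ω) and the ambient dual. The substantial inclusion rests on
`W1inf.exists_toDual_eq_of_tendsto`: limits in the dual never leave W^{1,∞}(Ω), so images of
sequentially closed sets are sequentially closed. -/
theorem W1inf.closure_seqTopology_eq_preimage [IsFiniteMeasure (volume.restrict Ω)]
    (hΩ : IsOpen Ω) (A : Set (W1inf Ω)) (hK : IsClosed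
      (@closure _ (seqTopology inferInstance) (W1inf.toDual Ω '' A))) :
    @closure _ (seqTopology (W1inf.weakStar Ω)) A
      = W1inf.toDual Ω ⁻¹' (@closure _ (seqTopology inferInstance) (W1inf.toDual Ω '' A)) := by
  let tW : TopologicalSpace (W1inf Ω) := W1inf.weakStar Ω
  apply Set.Subset.antisymm
  · refine @closure_minimal _ (seqTopology (W1inf.weakStar Ω)) _ _ ?_ ?_
    · exact Set.image_subset_iff.1 (@subset_closure _ (seqTopology inferInstance) _)
    · rw [isClosed_seqTopology_iff]
      exact (hK.preimage (W1inf.continuous_toDual Ω)).isSeqClosed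
  · set B := @closure _ (seqTopology (W1inf.weakStar Ω)) A
    have hB : IsSeqClosed B := (isClosed_seqTopology_iff _).1
      (@isClosed_closure _ (seqTopology (W1inf.weakStar Ω)) A)
    have hTB : IsSeqClosed (W1inf.toDual Ω '' B) := by
      intro y l hy hyl
      choose a haB ha using hy
      obtain rfl : (fun n => W1inf.toDual Ω (a n)) = y := funext ha
      obtain ⟨z, rfl⟩ := W1inf.exists_toDual_eq_of_tendsto hyl
      exact ⟨z, hB haB (W1inf.tendsto_weakStar_iff.2 hyl), rfl⟩
    have hsub : @closure _ (seqTopology inferInstance) (W1inf.toDual Ω '' A)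
        ⊆ W1inf.toDual Ω '' B := @closure_minimal _ (seqTopology inferInstance) _ _
      (Set.image_mono (@subset_closure _ (seqTopology (W1inf.weakStar Ω)) A))
      ((isClosed_seqTopology_iff _).2 hTB)
    intro w hw
    obtain ⟨z, hz, hzw⟩ := hsub hw
    have h : z = w := W1inf.eq_of_toDual_apply_eq hΩ fun p =>
      congrArg (fun l : WeakDual ℝ _ => l (p, 0)) hzw
    exact h ▸ hz

end WeakStar

/-! ### Piecewise affine functions with slopes `0` and `1` approximating `s ↦ t * s` -/

section Staircase

/-- The continuous function that vanishes at `0` and has slope `1` on `[k, k + t)` and slope `0` on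
`[k + t, k + 1)` for all integers `k`. -/
def ramp (t s : ℝ) : ℝ := t * ⌊s⌋ + min (Int.fract s) t

theorem abs_ramp_sub_le {t : ℝ} (h0 : 0 ≤ t) (h1 : t ≤ 1) (s : ℝ) : |ramp t s - t * s| ≤ 1 := by
  have hf0 := Int.fract_nonneg s
  have hf1 := (Int.fract_lt_one s).le
  have hs : ramp t s - t * s = min (Int.fract s) t - t * Int.fract s := by
    rw [ramp, Int.fract]; ring
  rw [hs, abs_le]
  have h2 : t * Int.fract s ≤ 1 := mul_le_one₀ h1 hf0 hf1
  have h3 : 0 ≤ t * Int.fract s := mul_nonneg h0 hf0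
  constructor
  · linarith [le_min hf0 h0]
  · linarith [min_le_left (Int.fract s) t]

theorem monotone_ramp {t : ℝ} (h0 : 0 ≤ t) : Monotone (ramp t) := by
  intro a b hab
  rcases (Int.floor_mono hab).eq_or_lt with h | h
  · have hfr : Int.fract a ≤ Int.fract b := by
      rw [Int.fract, Int.fract, h]; linarith
    rw [ramp, ramp, h]
    gcongr
  · have h' : (⌊a⌋ : ℝ) + 1 ≤ ⌊b⌋ := by exact_mod_cast h
    have := mul_le_mul_of_nonneg_left h' h0
    have h2 := min_le_right (Int.fract a) t
    have h3 := le_min (Int.fract_nonneg b) h0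
    rw [ramp, ramp]
    linarith

theorem monotone_sub_ramp {t : ℝ} (h1 : t ≤ 1) : Monotone fun s => s - ramp t s := by
  have hs : ∀ s, s - ramp t s = (1 - t) * ⌊s⌋ + max 0 (Int.fract s - t) := fun s => by
    have : max 0 (Int.fract s - t) = Int.fract s - min (Int.fract s) t := by
      rcases le_total (Int.fract s) t with h | h
      · rw [min_eq_left h, max_eq_left (by linarith)]; ring
      · rw [min_eq_right h, max_eq_right (by linarith)]
    rw [this, ramp, Int.fract]; ring
  intro a b hab
  simp only [hs]
  rcases (Int.floor_mono hab).eq_or_lt with h | h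
  · have hfr : Int.fract a ≤ Int.fract b := by
      rw [Int.fract, Int.fract, h]; linarith
    rw [h]
    gcongr
  · have h' : (⌊a⌋ : ℝ) + 1 ≤ ⌊b⌋ := by exact_mod_cast h
    have := mul_le_mul_of_nonneg_left h' (sub_nonneg.2 h1)
    have h2 : max 0 (Int.fract a - t) ≤ 1 - t :=
      max_le (by linarith) (by linarith [Int.fract_lt_one a])
    have h3 := le_max_left 0 (Int.fract b - t)
    linarith

/-- Both the ramp and the identity minus the ramp are nondecreasing, so increments of the ramp lie
between 0 and those of the identity. -/
theorem lipschitzWith_ramp {t : ℝ} (h0 : 0 ≤ t) (h1 : t ≤ 1) : LipschitzWith 1 (ramp t) := by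
  refine LipschitzWith.of_le_add fun a b => ?_
  rcases le_total a b with h | h
  · exact (monotone_ramp h0 h).trans (by linarith [dist_nonneg (x := a) (y := b)])
  · have := monotone_sub_ramp h1 h
    simp only at this
    rw [Real.dist_eq, abs_of_nonneg (by linarith)]
    linarith

/-- Immediately to the right of `s` the floor is constant. The strict inequality matters at the
kink: when the fractional part equals `t`, the slope to the right is already 0. -/
theorem hasDerivWithinAt_ramp (t s : ℝ) :
    HasDerivWithinAt (ramp t) (if Int.fract s < t then 1 else 0) (Set.Ioi s) s := by
  have hs1 : s < ⌊s⌋ + 1 := Int.lt_floor_add_one s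
  have hfl : ∀ s' ∈ Set.Ico s (⌊s⌋ + 1), ⌊s'⌋ = ⌊s⌋ := fun s' h =>
    Int.floor_eq_iff.2 ⟨(Int.floor_le s).trans h.1, h.2⟩
  have hev : ∀ᶠ s' in 𝓝[>] s, s' ∈ Set.Ico s (⌊s⌋ + 1) := by
    filter_upwards [Ioo_mem_nhdsGT hs1] with s' h using ⟨h.1.le, h.2⟩
  split_ifs with h
  · have hst : s < ⌊s⌋ + t := by rw [Int.fract] at h; linarith
    have hd : HasDerivWithinAt (fun s' : ℝ => t * ⌊s⌋ + (s' - ⌊s⌋)) 1 (Set.Ioi s) s :=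
      (((hasDerivAt_id s).sub_const _).const_add _).hasDerivWithinAt
    refine hd.congr_of_eventuallyEq ?_ ?_
    · filter_upwards [hev, Ioo_mem_nhdsGT hst] with s' h1 h2
      rw [ramp, Int.fract, hfl s' h1, min_eq_left (by linarith [h2.2])]
    · rw [ramp, Int.fract, min_eq_left (by linarith)]
  · have hst : ⌊s⌋ + t ≤ s := by rw [Int.fract] at h; linarith
    have hd : HasDerivWithinAt (fun _ : ℝ => t * ⌊s⌋ + t) 0 (Set.Ioi s) s :=
      hasDerivWithinAt_const _ _ _
    refine hd.congr_of_eventuallyEq ?_ ?_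
    · filter_upwards [hev] with s' h1
      rw [ramp, Int.fract, hfl s' h1, min_eq_right (by linarith [h1.1])]
    · rw [ramp, Int.fract, min_eq_right (by linarith)]

/-- The ramp function rescaled by the factor `1 / (n + 1)`. -/
def scaledRamp (t : ℝ) (n : ℕ) (s : ℝ) : ℝ := (n + 1 : ℝ)⁻¹ * ramp t ((n + 1) * s)

theorem lipschitzWith_scaledRamp {t : ℝ} (h0 : 0 ≤ t) (h1 : t ≤ 1) (n : ℕ) :
    LipschitzWith 1 (scaledRamp t n) := by
  refine LipschitzWith.of_dist_le_mul fun a b => ?_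
  have hn : (0 : ℝ) < n + 1 := by positivity
  have := (lipschitzWith_ramp h0 h1).dist_le_mul ((n + 1) * a) ((n + 1) * b)
  rw [Real.dist_eq, Real.dist_eq, ← mul_sub, abs_mul, abs_of_pos hn] at this
  rw [Real.dist_eq, Real.dist_eq, scaledRamp, scaledRamp, ← mul_sub, abs_mul, abs_inv,
    abs_of_pos hn, inv_mul_le_iff₀ hn]
  simpa using this

theorem scaledRamp_zero {t : ℝ} (h0 : 0 ≤ t) (n : ℕ) : scaledRamp t n 0 = 0 := by
  simp [scaledRamp, ramp, h0]

/-- The unscaled ramp stays within 1 of the line of slope `t`, and rescaling shrinks this error to 1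
/ (n + 1). -/
theorem tendsto_scaledRamp {t : ℝ} (h0 : 0 ≤ t) (h1 : t ≤ 1) (s : ℝ) :
    Tendsto (fun n => scaledRamp t n s) atTop (𝓝 (t * s)) := by
  rw [tendsto_iff_dist_tendsto_zero]
  refine squeeze_zero (fun _ => dist_nonneg) (fun n => ?_)
    (tendsto_one_div_add_atTop_nhds_zero_nat (𝕜 := ℝ))
  have hn : (0 : ℝ) < n + 1 := by positivity
  have h := abs_ramp_sub_le h0 h1 ((n + 1) * s)
  have e : scaledRamp t n s - t * s
      = (n + 1 : ℝ)⁻¹ * (ramp t ((n + 1) * s) - t * ((n + 1) * s)) := by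
    rw [scaledRamp]; field_simp
  rw [Real.dist_eq, e, abs_mul, abs_inv, abs_of_pos hn, one_div]
  exact mul_le_of_le_one_right (by positivity) h

theorem hasDerivWithinAt_scaledRamp (t : ℝ) (n : ℕ) (s : ℝ) :
    HasDerivWithinAt (scaledRamp t n) (if Int.fract ((n + 1) * s) < t then 1 else 0)
      (Set.Ioi s) s := by
  have hn : (0 : ℝ) < n + 1 := by positivity
  have h1 : HasDerivWithinAt (fun s : ℝ => (n + 1) * s) ((n + 1) * 1) (Set.Ioi s) s :=
    ((hasDerivAt_id s).const_mul _).hasDerivWithinAt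
  have h := ((hasDerivWithinAt_ramp t ((n + 1) * s)).comp s h1
    (fun s' hs' => mul_lt_mul_of_pos_left hs' hn)).const_mul (n + 1 : ℝ)⁻¹
  refine h.congr_deriv ?_
  field_simp

end Staircase

/-! ### Sublevel sets of supremal functionals -/

section Supremal

variable {N : ℕ} {Ω : Set (EuclideanSpace ℝ (Fin N))}
  {f : EuclideanSpace ℝ (Fin N) → EuclideanSpace ℝ (Fin N) → EReal}

/-- Membership in a sublevel set is an almost everywhere constraint on the gradient alone, so
gradients of two members may be mixed freely from point to point. -/
theorem supremal_le_iff {w : W1inf Ω} {c : EReal} :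
    supremal Ω f w ≤ c ↔ ∀ᵐ x ∂volume.restrict Ω, f x (W1inf.grad w x) ≤ c := by
  refine ⟨fun h => ?_, fun h => essSup_le_of_ae_le c h⟩
  filter_upwards [ae_le_essSup (f := fun x => f x (W1inf.grad w x)) (μ := volume.restrict Ω)]
    with x hx using hx.trans h

/-- Segments between points of a sublevel set of a supremal functional consist of weak* limits of
sequences in this sublevel set. -/
theorem exists_seq_supremal_le_tendsto [IsFiniteMeasure (volume.restrict Ω)] (hΩ : IsOpen Ω)
    {c : EReal} {w₁ w₂ : W1inf Ω} (h₁ : supremal Ω f w₁ ≤ c) (h₂ : supremal Ω f w₂ ≤ c) {t : ℝ}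
    (ht0 : 0 ≤ t) (ht1 : t ≤ 1) :
    ∃ z : ℕ → W1inf Ω, (∀ n, supremal Ω f (z n) ≤ c) ∧ Tendsto (fun n => W1inf.toDual Ω (z n)) atTop
      (𝓝 (W1inf.toDual Ω (w₁ + t • (w₂ - w₁)))) := by
  set d := w₂ - w₁ with hd
  have hcomp := fun n : ℕ => W1inf.exists_comp hΩ d (lipschitzWith_scaledRamp ht0 ht1 n)
    (hasDerivWithinAt_scaledRamp t n)
    (Measurable.ite (measurableSet_lt (measurable_fract.comp (measurable_const_mul _))
      measurable_const) measurable_const measurable_const)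
    (fun s => by split_ifs <;> simp)
  choose z hzf hzg using hcomp
  have hramp : ∀ n s, ‖scaledRamp t n s‖ ≤ ‖s‖ := fun n s => by
    have := (lipschitzWith_scaledRamp ht0 ht1 n).dist_le_mul s 0
    simpa [scaledRamp_zero ht0] using this
  refine ⟨fun n => w₁ + z n, fun n => ?_, ?_⟩
  · rw [supremal_le_iff] at h₁ h₂ ⊢
    filter_upwards [h₁, h₂, hzg n, Lp.coeFn_add (W1inf.grad w₁) (W1inf.grad (z n)),
      Lp.coeFn_sub (W1inf.grad w₂) (W1inf.grad w₁)] with x e1 e2 e3 e4 e5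
    have e4' : W1inf.grad (w₁ + z n) x = W1inf.grad w₁ x + W1inf.grad (z n) x := e4
    have e5' : W1inf.grad d x = W1inf.grad w₂ x - W1inf.grad w₁ x := e5
    rw [e4', e3, e5']
    -- Slope 1 turns the gradient into that of `w₂`, slope 0 leaves that of `w₁`.
    split_ifs
    · simpa using e2
    · simpa using e1
  · simp only [map_add, map_smul]
    refine Tendsto.const_add _ ?_
    rw [← map_smul]
    -- Slopes in {0, 1} bound the gradients by that of `d`, and ramps that are 1-Lipschitz and
    -- vanish at 0 bound the functions by `d`. Only the functions are left to test, by dominated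
    -- convergence.
    refine W1inf.tendsto_toDual_of_bounded hΩ (R := ‖W1inf.fn d‖) (R' := ‖W1inf.grad d‖)
      (fun n => ?_) (fun n => ?_) fun p => ?_
    · refine Lp.norm_le_norm_of_ae_le ?_
      filter_upwards [hzf n] with x hx
      rw [hx]
      exact hramp n _
    · refine Lp.norm_le_norm_of_ae_le ?_
      filter_upwards [hzg n] with x hx
      rw [hx]
      split_ifs <;> simp
    · simp only [W1inf.toDual_apply, map_zero, add_zero, lInfPairing_real_apply]
      have hint : Integrable (fun x => W1inf.fn d x * p x) (volume.restrict Ω) :=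
        memLp_one_iff_integrable.1 ((Lp.memLp p).mul (Lp.memLp (W1inf.fn d)))
      refine tendsto_integral_of_dominated_convergence (fun x => ‖W1inf.fn d x * p x‖)
        (fun n => (Lp.aestronglyMeasurable _).mul (Lp.aestronglyMeasurable _)) hint.norm
        (fun n => ?_) ?_
      · filter_upwards [hzf n] with x hx
        rw [hx, norm_mul, norm_mul]
        gcongr
        exact hramp n _
      · filter_upwards [ae_all_iff.2 hzf, Lp.coeFn_smul t (W1inf.fn d)] with x hx hs
        have hs' : W1inf.fn (t • d) x = t * W1inf.fn d x := hs
        simp only [hx, hs']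
        exact (tendsto_scaledRamp ht0 ht1 _).mul_const _

theorem LinearMap.map_segment {V W : Type*} [AddCommGroup V] [Module ℝ V] [AddCommGroup W]
    [Module ℝ W] (T : V →ₗ[ℝ] W) {a b : ℝ} (hab : a + b = 1) (x y : V) :
    T (x + b • (y - x)) = a • T x + b • T y := by
  rw [map_add, map_smul, map_sub, eq_sub_of_add_eq hab]
  module

theorem isClosed_closure_image_toDual_supremal_le [IsFiniteMeasure (volume.restrict Ω)]
    (hΩ : IsOpen Ω) (c : EReal) :
    IsClosed (@closure _ (seqTopology inferInstance)
      (W1inf.toDual Ω '' {w | supremal Ω f w ≤ c})) := by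
  have := separableSpace_lp_one (E := ℝ) (μ := volume.restrict Ω)
  have := separableSpace_lp_one (E := EuclideanSpace ℝ (Fin N)) (μ := volume.restrict Ω)
  have h := @isClosed_closure_seqTopology_weakDual (Lp ℝ 1 (volume.restrict Ω) ×
      Lp (EuclideanSpace ℝ (Fin N)) 1 (volume.restrict Ω)) _ _ _ _
    (W1inf.toDual Ω '' {w | supremal Ω f w ≤ c})
  refine h ?_
  clear h
  refine Set.forall_mem_image.2 fun w₁ h₁ => ?_
  refine Set.forall_mem_image.2 fun w₂ h₂ => ?_
  intro a b ha hb hab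
  have hb1 : b ≤ 1 := by linarith
  have hseq := exists_seq_supremal_le_tendsto (f := f) (c := c) (w₁ := w₁) (w₂ := w₂) (t := b) hΩ
    h₁ h₂ hb.le hb1
  rw [LinearMap.map_segment (W1inf.toDual Ω) hab w₁ w₂] at hseq
  obtain ⟨z, hz, hzt⟩ := hseq
  exact ⟨fun n => W1inf.toDual Ω (z n), fun n => Set.mem_image_of_mem _ (hz n), hzt⟩

/-- The sequential weak* closures of the sublevel sets of a supremal functional are weak* closed. -/
theorem isClosed_closure_supremal_le (hΩ : IsOpen Ω) (hb : Bornology.IsBounded Ω) (c : EReal) :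
    IsClosed[W1inf.weakStar Ω]
      (@closure _ (seqTopology (W1inf.weakStar Ω)) {w | supremal Ω f w ≤ c}) := by
  have : IsFiniteMeasure (volume.restrict Ω) := isFiniteMeasure_restrict.2 hb.measure_lt_top.ne
  have hK := isClosed_closure_image_toDual_supremal_le (f := f) hΩ c
  rw [W1inf.closure_seqTopology_eq_preimage hΩ _ hK]
  exact @IsClosed.preimage _ _ (W1inf.weakStar Ω) _ _ (W1inf.continuous_toDual Ω) _ hK

end Supremal

end

/-- The proof works for every bounded open set and every supremand: the chain rule makes the sequential
weak* closures of the sublevel sets of a supremal functional convex, and Krein–Šmulian makes them weak*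
closed. The regularity of the boundary and the minimizing sequence play no role. -/
theorem mainTheorem2 {N : ℕ} (Ω : Set (EuclideanSpace ℝ (Fin N)))
    (hopen : IsOpen Ω) (hb : Bornology.IsBounded Ω) (hconn : IsConnected Ω)
    (hLip : HasLipschitzBoundary Ω)
    (f : EuclideanSpace ℝ (Fin N) → EuclideanSpace ℝ (Fin N) → EReal)
    (hf : Measurable (fun p : Ω × EuclideanSpace ℝ (Fin N) => f p.1 p.2))
    (hH : HasContinuityMinimizingSeq hb (supremal Ω f)) :
    lscEnvelope (W1inf.weakStar Ω) (supremal Ω f)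
        = lscEnvelope (seqTopology (W1inf.weakStar Ω)) (supremal Ω f) ∧
      (@LowerSemicontinuous (W1inf Ω) EReal (W1inf.weakStar Ω) _ (supremal Ω f) ↔
        SeqLowerSemicontinuous (W1inf.weakStar Ω) (supremal Ω f)) :=
  ⟨lscEnvelope_eq_seqTopology _ _ (isClosed_closure_supremal_le hopen hb),
    lowerSemicontinuous_iff_seqLowerSemicontinuous _ _ (isClosed_closure_supremal_le hopen hb)⟩
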